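/- For real $\alpha,\beta>0$ with $\alpha\neq\beta$ let $F^{(\alpha,\beta)}\colon(0,\infty)^2\to(0,\infty)^2$ be the map $$F^{(\alpha,\beta)}(x,y)=\left(\frac{y}{\alpha}\cdot\frac{\beta+\alpha x+\beta y+\alpha\beta xy}{1+x+y+\beta xy},\ \frac{x}{\beta}\cdot\frac{\alpha+\alpha x+\beta y+\alpha\beta xy}{1+x+y+\alpha xy}\right).$$ For $\gamma,p,q>0$ and $-q<\nu<p$ let $\mathrm{GB}_{II}(\nu,p,q;\gamma)$ (the generalized second kind beta distribution) be the probability distribution on $\mathbb R$ with density $$\frac{1}{B(q+\nu,p-\nu)\,{}_2F_1(p+\nu,q+\nu;p+q;1-\gamma)}\cdot\frac{x^{q+\nu-1}}{(1+\gamma x)^{p+\nu}(1+x)^{q-\nu}}\,\mathbf 1_{(0,\infty)}(x),$$ where $B(r,s)=\Gamma(r)\Gamma(s)/\Gamma(r+s)$ for $r,s>0$ and ${}_2F_1(r,s;c;z)=\frac{1}{B(s,c-s)}\int_0^1 t^{s-1}(1-t)^{c-s-1}(1-zt)^{-r}\,dt$ for $c>s>0$, $z<1$. Theorem. Let $\alpha,\beta>0$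 with $\alpha\ne\beta$, let $X$ and $Y$ be independent positive random variables, neither of which is almost surely constant, and set $(U,V)=F^{(\alpha,\beta)}(X,Y)$. If $U$ and $V$ are independent, then there exist $a,b>0$ and $\lambda\in\mathbb R$ with $|\lambda|<\min\{a,b\}$ such that $$(X,Y)\sim \mathrm{GB}_{II}(\lambda,a,b;\alpha)\otimes \mathrm{GB}_{II}(-\lambda,a,b;\beta)$$ and $$(U,V)\sim \mathrm{GB}_{II}(-\lambda,a,b;\alpha)\otimes \mathrm{GB}_{II}(\lambda,a,b;\beta).$$ -/

import Mathlib

open MeasureTheory ProbabilityTheory Set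

/-- The quadrirational Yang-Baxter map `F^{(α,β)}` of `(0,∞)²`, written as a formula on `ℝ × ℝ`. -/
noncomputable def quadrirationalYB (α β : ℝ) (p : ℝ × ℝ) : ℝ × ℝ :=
  (p.2 / α * ((β + α * p.1 + β * p.2 + α * β * p.1 * p.2) / (1 + p.1 + p.2 + β * p.1 * p.2)),
   p.1 / β * ((α + α * p.1 + β * p.2 + α * β * p.1 * p.2) / (1 + p.1 + p.2 + α * p.1 * p.2)))

/-- The Gauss hypergeometric function `₂F₁(a,b;c;z)` for real `c > b > 0` and `z < 1`, through
Euler's integral. (The hypergeometric power series diverges for `z < -1`, and such values are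
needed.) -/
noncomputable def gaussHypergeometric (a b c z : ℝ) : ℝ :=
  1 / beta b (c - b) *
    ∫ t in (0 : ℝ)..1, t ^ (b - 1) * (1 - t) ^ (c - b - 1) * (1 - z * t) ^ (-a)

/-- The density of the generalized second kind beta distribution `GB_II(ν,p,q;γ)`, for
`γ, p, q > 0` and `-q < ν < p`. -/
noncomputable def gbIIPDFReal (ν p q γ x : ℝ) : ℝ :=
  (Ioi (0 : ℝ)).indicator
    (fun x => 1 / (beta (q + ν) (p - ν) *
        gaussHypergeometric (p + ν) (q + ν) (p + q) (1 - γ)) *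
      (x ^ (q + ν - 1) / ((1 + γ * x) ^ (p + ν) * (1 + x) ^ (q - ν)))) x

/-- The generalized second kind beta distribution `GB_II(ν,p,q;γ)` on `ℝ`. -/
noncomputable def gbIIMeasure (ν p q γ : ℝ) : Measure ℝ :=
  volume.withDensity fun x => ENNReal.ofReal (gbIIPDFReal ν p q γ x)

/-!
The map `(x, y) ↦ (u, v) = F(x, y)` preserves a three-parameter family of products of powers.
With `A = β + αx + βy + αβxy`, `B = 1 + x + y + βxy`, `C = α + αx + βy + αβxy` and
`D = 1 + x + y + αxy`, each of `u`, `1 + u`, `1 + αu`, `v`, `1 + v`, `1 + βv` is a monomial in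
`A, B, C, D`, the constants and the corresponding linear factors in `x` and `y`
(`quadrirationalYB_factors`). Choosing exponents for which `A, B, C, D` cancel gives, for
`i + l = j + k` and up to a constant,
`x^i (1+x)^(-j) (1+αx)^(-k) · y^j (1+y)^(-i) (1+βy)^(-l)`
`  = v^i (1+v)^(-j) (1+βv)^(-k) · u^j (1+u)^(-i) (1+αu)^(-l)`.
All these functions are bounded when `i ≤ j + k`, so independence of `(X, Y)` and of `(U, V)` turns
this into a relation `X(i,j,k) Y(j,i,l) = V(i,j,k) U(j,i,l)` between moments
(`IndepPreserving.betaMoment_mul`), with no assumption on the laws.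

The moments of each variable satisfy three-term relations, coming from `(1 + x) - x = 1` and
`(1 + γx) - γx = 1`. On the six indices of a hexagon these linear relations for `X`, `Y`, `U`, `V`,
together with the product relations, force the ratio `N = V / Y` to satisfy
`N₁ N₂₃ = N₂ N₁₃ = N₃ N₁₂` (`hexagon_relations`). The elimination divides by a quantity that vanishes
only if `X` and `V` have equal means under a common tilt; this does not happen, as `V - X` has
the constant sign of `α - β` (`IndepPreserving.betaMoment_ratio_ne`). As a consequence each of the
four laws satisfies linear contiguous relations whose coefficients, suitably normalised, are
`c + t i` and `d + t j` with `t ≥ 0` (`IndepPreserving.exists_contiguous`). If `t = 0`, then `V` is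
concentrated on the zeros of a quadratic polynomial, whereas `V` takes at least three values
because `X` and `Y` are not constant. For `t > 0` the relations are the Stein identity, tested on
the powers of `x / (1 + x)`, of a law `GB_II`.

That identity determines the law (`eq_withDensity_betaWeight`): by Weierstrass approximation it holds
for all test functions that are `C¹` with compact support in `(0, ∞)`, and solving the first order
linear equation `x g' + Q g = h` shows that `∫ h dμ` is proportional to the integral of `h` against
the weight. In terms of the coefficients `c, d, t`, the parameters are determined by
`b + λ = c/t`, `b - λ = d/t` and `a + λ = 1/(βt)`, and the inequality `|λ| < min a b` expresses the
positivity of `c`, `d`, `t` and `d + 1/β - c`.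
-/

/-! ### Algebra of one hexagon of moments -/

/-- The elimination at the heart of the proof. The `V`'s and `y`'s are moments of the laws of `V` and
`Y` at the six vertices `p + eᵢ`, `p + eᵢ + eⱼ` of a cube, `r` is the ratio between the moments of
`X` and `V`, and also (after rescaling) the one between those of `U` and `Y`. The twelve linear
relations make the six differences `D₁, …, D₆` proportional to each other in pairs, so
that they are all nonzero as soon as one of them is. -/
lemma hexagon_relations {α β V₁ V₂ V₃ V₁₂ V₁₃ V₂₃ y₁ y₂ y₃ y₁₂ y₁₃ y₂₃
    r₁ r₂ r₃ r₁₂ r₁₃ r₂₃ : ℝ} (hβ : 0 < β)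
    (hV₁₂ : 0 < V₁₂) (hV₁₃ : 0 < V₁₃) (hV₂₃ : 0 < V₂₃)
    (hy₁ : 0 < y₁) (hy₃ : 0 < y₃)
    (v₁ : V₁₃ = (1 - β) * V₁ + β * V₁₂) (v₂ : V₂₃ = V₂ + β * V₁₂) (v₃ : V₂₃ = V₃ + V₁₃)
    (x₁ : r₁₃ * V₁₃ = (1 - α) * (r₁ * V₁) + α * (r₁₂ * V₁₂))
    (x₂ : r₂₃ * V₂₃ = r₂ * V₂ + α * (r₁₂ * V₁₂)) (x₃ : r₂₃ * V₂₃ = r₃ * V₃ + r₁₃ * V₁₃)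
    (e₁ : y₁₂ = y₂ + (β - 1) * y₁) (e₂ : y₁₃ = β * y₃ + (1 - β) * y₁) (e₃ : y₂₃ = y₂ + β * y₃)
    (u₁ : α * (r₁₂ * y₁₂) = β * (r₂ * y₂ + (α - 1) * (r₁ * y₁)))
    (u₂ : r₁₃ * y₁₃ = β * (r₃ * y₃) + (1 - α) * (r₁ * y₁))
    (u₃ : r₂₃ * y₂₃ = r₂ * y₂ + β * (r₃ * y₃)) (hr : r₃ - r₁₃ ≠ 0) :
    V₂ * V₁₃ * (y₃ * y₁₂) = V₃ * V₁₂ * (y₂ * y₁₃) ∧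
      V₁ * V₂₃ * (y₃ * y₁₂) = V₃ * V₁₂ * (y₁ * y₂₃) := by
  -- opaque names, so that the `Dᵢ` stay atoms in the divisions below
  obtain ⟨D₁, hD₁⟩ : ∃ D, D = (1 - α) * r₁ * β - (1 - β) * α * r₁₂ := ⟨_, rfl⟩
  obtain ⟨D₂, hD₂⟩ : ∃ D, D = (1 - α) * r₁ - (1 - β) * r₁₃ := ⟨_, rfl⟩
  obtain ⟨D₃, hD₃⟩ : ∃ D, D = β * r₂ - α * r₁₂ := ⟨_, rfl⟩
  obtain ⟨D₄, hD₄⟩ : ∃ D, D = r₂ - r₂₃ := ⟨_, rfl⟩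
  obtain ⟨D₅, hD₅⟩ : ∃ D, D = r₃ - r₁₃ := ⟨_, rfl⟩
  obtain ⟨D₆, hD₆⟩ : ∃ D, D = r₃ - r₂₃ := ⟨_, rfl⟩
  have a₁ : D₁ * V₁₂ = D₂ * V₁₃ := by
    rw [hD₁, hD₂]; linear_combination (1 - β) * x₁ - (1 - α) * r₁ * v₁
  have a₂ : D₃ * V₁₂ = D₄ * V₂₃ := by rw [hD₃, hD₄]; linear_combination x₂ - r₂ * v₂
  have a₃ : D₅ * V₁₃ = D₆ * V₂₃ := by rw [hD₅, hD₆]; linear_combination x₃ - r₃ * v₃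
  have b₁ : D₃ * y₂ = D₁ * y₁ := by
    rw [hD₃, hD₁]; linear_combination α * r₁₂ * e₁ - u₁
  have b₂ : β * D₅ * y₃ = -D₂ * y₁ := by
    rw [hD₅, hD₂]; linear_combination r₁₃ * e₂ - u₂
  have b₃ : -D₄ * y₂ = β * D₆ * y₃ := by
    rw [hD₄, hD₆]; linear_combination u₃ - r₂₃ * e₃
  have n₅ : D₅ ≠ 0 := hD₅ ▸ hr
  have n₆ : D₆ ≠ 0 := fun h => by simp [h, n₅, hV₁₃.ne'] at a₃
  have n₂ : D₂ ≠ 0 := fun h => by simp [h, n₅, hβ.ne', hy₃.ne'] at b₂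
  have n₁ : D₁ ≠ 0 := fun h => by simp [h, n₂, hV₁₃.ne'] at a₁
  have n₄ : D₄ ≠ 0 := fun h => by simp [h, n₆, hβ.ne', hy₃.ne'] at b₃
  have n₃ : D₃ ≠ 0 := fun h => by simp [h, n₄, hV₂₃.ne'] at a₂
  have H : D₂ * D₆ * D₃ = D₁ * D₅ * D₄ := by
    have : (D₂ * D₆ * D₃ - D₁ * D₅ * D₄) * (V₁₂ * V₁₃ * V₂₃) = 0 := by
      linear_combination (-D₅ * V₁₃ * D₄ * V₂₃) * a₁ + D₂ * V₁₃ * D₆ * V₂₃ * a₂ -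
        D₂ * V₁₃ * D₄ * V₂₃ * a₃
    have h0 : V₁₂ * V₁₃ * V₂₃ ≠ 0 := by positivity
    linear_combination (mul_eq_zero.1 this).resolve_right h0
  have c₁ : V₁₃ = D₆ / D₅ * V₂₃ := by field_simp; linear_combination a₃
  have c₂ : V₁₂ = D₄ / D₃ * V₂₃ := by field_simp; linear_combination a₂
  have c₃ : y₂ = D₁ / D₃ * y₁ := by field_simp; linear_combination b₁
  have c₄ : y₃ = -D₂ / (β * D₅) * y₁ := by field_simp; linear_combination b₂
  have c₅ : V₁ = (β * r₁₃ - α * r₁₂) / D₁ * V₁₃ := by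
    field_simp; rw [hD₁]; linear_combination α * r₁₂ * v₁ - β * x₁
  have c₆ : V₂ = V₂₃ - β * V₁₂ := by linear_combination -v₂
  have c₇ : V₃ = V₂₃ - V₁₃ := by linear_combination -v₃
  constructor
  · rw [e₁, e₂, c₆, c₇, c₁, c₂, c₃, c₄]
    field_simp
    clear a₁ a₂ a₃ b₁ b₂ b₃ c₁ c₂ c₃ c₄ c₅ c₆ c₇
    subst hD₁ hD₂ hD₃ hD₄ hD₅ hD₆
    linear_combination β * (-((1 - α) * r₁ - (1 - β) * r₂) - (1 - β) * (r₂ - r₂₃)) * H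
  · rw [e₁, e₃, c₇, c₅, c₁, c₂, c₃, c₄]
    field_simp
    clear a₁ a₂ a₃ b₁ b₂ b₃ c₁ c₂ c₃ c₄ c₅ c₆ c₇
    subst hD₁ hD₂ hD₃ hD₄ hD₅ hD₆
    linear_combination -β * ((β * r₁₃ - α * r₁₂) * ((1 - α) * r₁ - (1 - β) * r₂) +
      ((1 - α) * r₁ * β - (1 - β) * α * r₁₂) * (r₂ - r₂₃)) * H

/-! ### The Yang-Baxter map and its moments -/

/-- The kernel `x^i (1 + x)^(-j) (1 + γ x)^(-k)`, bounded on `(0, ∞)` when `i ≤ j + k`. -/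
noncomputable def betaKernel (γ : ℝ) (i j k : ℕ) (x : ℝ) : ℝ :=
  x ^ i / ((1 + x) ^ j * (1 + γ * x) ^ k)

lemma measurable_quadrirationalYB (α β : ℝ) : Measurable (quadrirationalYB α β) := by
  unfold quadrirationalYB; fun_prop

/-- The multiplicative structure of the map: the linear factors in the image point are monomials in
the linear factors in `x`, in `y`, and in four bilinear polynomials. -/
lemma quadrirationalYB_factors {α β x y : ℝ} (hα : 0 < α) (hβ : 0 < β) (hx : 0 < x) (hy : 0 < y) :
    ∃ A B C D : ℝ, 0 < A ∧ 0 < B ∧ 0 < C ∧ 0 < D ∧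
      (quadrirationalYB α β (x, y)).1 = y * A / (α * B) ∧
      1 + (quadrirationalYB α β (x, y)).1 = (1 + y) * C / (α * B) ∧
      1 + α * (quadrirationalYB α β (x, y)).1 = (1 + β * y) * D / B ∧
      (quadrirationalYB α β (x, y)).2 = x * C / (β * D) ∧
      1 + (quadrirationalYB α β (x, y)).2 = (1 + x) * A / (β * D) ∧
      1 + β * (quadrirationalYB α β (x, y)).2 = (1 + α * x) * B / D := by
  have hB : 0 < 1 + x + y + β * x * y := by positivity
  have hD : 0 < 1 + x + y + α * x * y := by positivity
  refine ⟨β + α * x + β * y + α * β * x * y, 1 + x + y + β * x * y,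
    α + α * x + β * y + α * β * x * y, 1 + x + y + α * x * y, by positivity, hB, by positivity, hD,
    ?_, ?_, ?_, ?_, ?_, ?_⟩ <;> simp only [quadrirationalYB] <;> field_simp <;> ring

lemma quadrirationalYB_pos {α β x y : ℝ} (hα : 0 < α) (hβ : 0 < β) (hx : 0 < x) (hy : 0 < y) :
    0 < (quadrirationalYB α β (x, y)).1 ∧ 0 < (quadrirationalYB α β (x, y)).2 := by
  obtain ⟨A, B, C, D, hA, hB, hC, hD, h₁, -, -, h₂, -, -⟩ := quadrirationalYB_factors hα hβ hx hy
  rw [h₁, h₂]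
  constructor <;> positivity

/-- The three-parameter family of products preserved by the map: `i + l = j + k` is the condition for
the four bilinear polynomials to cancel. The indices of the kernels in `y` and `u` are those of
the kernels in `x` and `v` with the roles of the exponents `i` and `j` exchanged. -/
lemma betaKernel_mul_betaKernel {α β x y : ℝ} (hα : 0 < α) (hβ : 0 < β) (hx : 0 < x) (hy : 0 < y)
    {i j k l : ℕ} (h : i + l = j + k) :
    α ^ i * β ^ j * (betaKernel α i j k x * betaKernel β j i l y) =
      α ^ j * β ^ i * (betaKernel α j i l (quadrirationalYB α β (x, y)).1 *
        betaKernel β i j k (quadrirationalYB α β (x, y)).2) := by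
  obtain ⟨A, B, C, D, hA, hB, hC, hD, h₁, h₂, h₃, h₄, h₅, h₆⟩ :=
    quadrirationalYB_factors hα hβ hx hy
  unfold betaKernel
  rw [h₂, h₃, h₅, h₆, h₁, h₄]
  have hBp : B ^ i * B ^ l = B ^ j * B ^ k := by rw [← pow_add, ← pow_add, h]
  have hDp : D ^ i * D ^ l = D ^ j * D ^ k := by rw [← pow_add, ← pow_add, h]
  simp only [div_pow, mul_pow]
  have : 0 < 1 + x := by positivity
  have : 0 < 1 + y := by positivity
  have : 0 < 1 + α * x := by positivity
  have : 0 < 1 + β * y := by positivity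
  field_simp
  linear_combination (B ^ j * B ^ k ) * hDp - D ^ j * D ^ k * hBp

lemma betaKernel_pos {γ x : ℝ} (hγ : 0 < γ) (hx : 0 < x) (i j k : ℕ) :
    0 < betaKernel γ i j k x := by
  unfold betaKernel; positivity

lemma betaKernel_eq_add {γ x : ℝ} (hx : 0 < x) (i j k : ℕ) :
    betaKernel γ i j k x = betaKernel γ i (j + 1) k x + betaKernel γ (i + 1) (j + 1) k x := by
  unfold betaKernel
  have : 1 + x ≠ 0 := by positivity
  rw [← add_div, show x ^ i + x ^ (i + 1) = (1 + x) * x ^ i by ring,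
    show (1 + x) ^ (j + 1) * (1 + γ * x) ^ k = (1 + x) * ((1 + x) ^ j * (1 + γ * x) ^ k) by ring,
    mul_div_mul_left _ _ this]

lemma betaKernel_eq_add_mul {γ x : ℝ} (hγ : 0 < γ) (hx : 0 < x) (i j k : ℕ) :
    betaKernel γ i j k x = betaKernel γ i j (k + 1) x + γ * betaKernel γ (i + 1) j (k + 1) x := by
  unfold betaKernel
  have : 1 + γ * x ≠ 0 := by positivity
  rw [mul_div_assoc', ← add_div, show x ^ i + γ * x ^ (i + 1) = (1 + γ * x) * x ^ i by ring,
    show (1 + x) ^ j * (1 + γ * x) ^ (k + 1) =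
      (1 + γ * x) * ((1 + x) ^ j * (1 + γ * x) ^ k) by ring,
    mul_div_mul_left _ _ this]

lemma betaKernel_le {γ x : ℝ} (hγ : 0 < γ) (hx : 0 < x) {i j k : ℕ} (h : i ≤ j + k) :
    betaKernel γ i j k x ≤ max 1 γ⁻¹ ^ k := by
  obtain ⟨a, b, ha, hb, rfl⟩ : ∃ a b, a ≤ j ∧ b ≤ k ∧ i = a + b :=
    ⟨min i j, i - min i j, by omega, by omega, by omega⟩
  have h1 : 1 ≤ max 1 γ⁻¹ := le_max_left _ _
  have h2 : x ≤ max 1 γ⁻¹ * (1 + γ * x) := by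
    calc x ≤ γ⁻¹ * (1 + γ * x) := by
          rw [mul_add, ← mul_assoc, inv_mul_cancel₀ hγ.ne', one_mul]
          linarith [inv_pos.2 hγ]
      _ ≤ _ := by gcongr; exact le_max_right _ _
  have h3 : 1 ≤ max 1 γ⁻¹ * (1 + γ * x) := by nlinarith [mul_pos hγ hx]
  have h4 : x ^ a ≤ (1 + x) ^ j :=
    (pow_le_pow_left₀ hx.le (by linarith) a).trans (pow_le_pow_right₀ (by linarith) ha)
  have h5 : x ^ b ≤ (max 1 γ⁻¹ * (1 + γ * x)) ^ k :=
    (pow_le_pow_left₀ hx.le h2 b).trans (pow_le_pow_right₀ h3 hb)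
  unfold betaKernel
  rw [div_le_iff₀ (by positivity), pow_add]
  calc x ^ a * x ^ b ≤ (1 + x) ^ j * (max 1 γ⁻¹ * (1 + γ * x)) ^ k := by gcongr
    _ = _ := by rw [mul_pow]; ring

lemma measurable_betaKernel (γ : ℝ) (i j k : ℕ) : Measurable (betaKernel γ i j k) := by
  unfold betaKernel; fun_prop

lemma integrable_betaKernel {γ : ℝ} (hγ : 0 < γ) {μ : Measure ℝ} [IsFiniteMeasure μ]
    (hμ : ∀ᵐ x ∂μ, 0 < x) {i j k : ℕ} (h : i ≤ j + k) : Integrable (betaKernel γ i j k) μ := by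
  refine Integrable.of_bound (measurable_betaKernel γ i j k).aestronglyMeasurable
    (max 1 γ⁻¹ ^ k) ?_
  filter_upwards [hμ] with x hx
  rw [Real.norm_of_nonneg (betaKernel_pos hγ hx i j k).le]
  exact betaKernel_le hγ hx h

/-- The generalized moment `∫ x^i (1 + x)^(-j) (1 + γ x)^(-k) dμ`. -/
noncomputable def betaMoment (γ : ℝ) (μ : Measure ℝ) (i j k : ℕ) : ℝ :=
  ∫ x, betaKernel γ i j k x ∂μ

section betaMoment

variable {γ : ℝ} {μ : Measure ℝ} [IsProbabilityMeasure μ]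

lemma integral_pos_of_ae_pos {Ω : Type*} [MeasurableSpace Ω] {P : Measure Ω} [NeZero P]
    {f : Ω → ℝ} (hf : Integrable f P) (h : ∀ᵐ ω ∂P, 0 < f ω) : 0 < ∫ ω, f ω ∂P := by
  rw [integral_pos_iff_support_of_nonneg_ae (h.mono fun _ => le_of_lt) hf]
  have : P (Function.support f) = P univ := by
    refine measure_congr ?_
    filter_upwards [h] with ω hω
    exact propext ⟨fun _ => trivial, fun _ => hω.ne'⟩
  rw [this]
  exact Measure.measure_univ_pos.2 (NeZero.ne P)

lemma betaMoment_pos (hγ : 0 < γ) (hμ : ∀ᵐ x ∂μ, 0 < x) {i j k : ℕ} (h : i ≤ j + k) :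
    0 < betaMoment γ μ i j k :=
  integral_pos_of_ae_pos (integrable_betaKernel hγ hμ h)
    (hμ.mono fun _ hx => betaKernel_pos hγ hx i j k)

lemma betaMoment_eq_add (hγ : 0 < γ) (hμ : ∀ᵐ x ∂μ, 0 < x) {i j k : ℕ} (h : i ≤ j + k) :
    betaMoment γ μ i j k = betaMoment γ μ i (j + 1) k + betaMoment γ μ (i + 1) (j + 1) k := by
  unfold betaMoment
  rw [← integral_add (integrable_betaKernel hγ hμ (by omega))
    (integrable_betaKernel hγ hμ (by omega))]
  exact integral_congr_ae (hμ.mono fun x hx => betaKernel_eq_add hx i j k)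

lemma betaMoment_eq_add_mul (hγ : 0 < γ) (hμ : ∀ᵐ x ∂μ, 0 < x) {i j k : ℕ} (h : i ≤ j + k) :
    betaMoment γ μ i j k =
      betaMoment γ μ i j (k + 1) + γ * betaMoment γ μ (i + 1) j (k + 1) := by
  unfold betaMoment
  rw [← integral_const_mul, ← integral_add (integrable_betaKernel hγ hμ (by omega))
    ((integrable_betaKernel hγ hμ (by omega)).const_mul γ)]
  exact integral_congr_ae (hμ.mono fun x hx => betaKernel_eq_add_mul hγ hx i j k)

/-- A consequence of the identity `1 + γ x = γ (1 + x) + (1 - γ)`. -/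
lemma betaMoment_succ (hγ : 0 < γ) (hμ : ∀ᵐ x ∂μ, 0 < x) {i j k : ℕ} (h : i ≤ j + k + 1) :
    betaMoment γ μ i (j + 1) k =
      γ * betaMoment γ μ i j (k + 1) + (1 - γ) * betaMoment γ μ i (j + 1) (k + 1) := by
  have h1 := betaMoment_eq_add_mul hγ hμ (i := i) (j := j + 1) (k := k) (by omega)
  have h2 := betaMoment_eq_add hγ hμ (i := i) (j := j) (k := k + 1) (by omega)
  linear_combination h1 - γ * h2

end betaMoment

/-- The map `F^{(α,β)}` sends the product `μ ⊗ ν` of two laws on `(0, ∞)` to the product `ρ ⊗ σ`. Thus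
`μ, ν, ρ, σ` are the laws of `X, Y, U, V`. -/
structure IndepPreserving (α β : ℝ) (μ ν ρ σ : Measure ℝ) : Prop where
  pos_μ : ∀ᵐ x ∂μ, 0 < x
  pos_ν : ∀ᵐ y ∂ν, 0 < y
  pos_ρ : ∀ᵐ u ∂ρ, 0 < u
  pos_σ : ∀ᵐ v ∂σ, 0 < v
  map_eq : (μ.prod ν).map (quadrirationalYB α β) = ρ.prod σ

namespace IndepPreserving

variable {α β : ℝ} {μ ν ρ σ : Measure ℝ}

lemma ae_prod_pos (H : IndepPreserving α β μ ν ρ σ) :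
    ∀ᵐ p ∂μ.prod ν, 0 < p.1 ∧ 0 < p.2 :=
  (Measure.quasiMeasurePreserving_fst.ae H.pos_μ).and
    (Measure.quasiMeasurePreserving_snd.ae H.pos_ν)

lemma integral_prod_mul_comp [SFinite ρ] [SFinite σ] (H : IndepPreserving α β μ ν ρ σ) {f g : ℝ → ℝ}
    (hf : Measurable f) (hg : Measurable g) :
    ∫ p, f (quadrirationalYB α β p).1 * g (quadrirationalYB α β p).2 ∂μ.prod ν =
      (∫ u, f u ∂ρ) * ∫ v, g v ∂σ := by
  rw [← integral_prod_mul, ← H.map_eq,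
    integral_map (measurable_quadrirationalYB α β).aemeasurable]
  exact ((hf.comp measurable_fst).mul (hg.comp measurable_snd)).aestronglyMeasurable

variable [IsProbabilityMeasure μ] [IsProbabilityMeasure ν]
  [IsProbabilityMeasure ρ] [IsProbabilityMeasure σ]

lemma betaMoment_mul (H : IndepPreserving α β μ ν ρ σ) (hα : 0 < α) (hβ : 0 < β)
    {i j k l : ℕ} (h : i + l = j + k) :
    α ^ i * β ^ j * (betaMoment α μ i j k * betaMoment β ν j i l) =
      α ^ j * β ^ i * (betaMoment α ρ j i l * betaMoment β σ i j k) := by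
  unfold betaMoment
  rw [← H.integral_prod_mul_comp (measurable_betaKernel α j i l) (measurable_betaKernel β i j k),
    ← integral_prod_mul, ← integral_const_mul, ← integral_const_mul]
  refine integral_congr_ae ?_
  filter_upwards [H.ae_prod_pos] with p hp
  exact betaKernel_mul_betaKernel hα hβ hp.1 hp.2 h

end IndepPreserving

/-! ### A nondegenerate multiplicative relation between the moments -/

lemma quadrirationalYB_snd_sub {α β x y : ℝ} (hα : 0 < α) (hβ : 0 < β) (hx : 0 < x)
    (hy : 0 < y) : (quadrirationalYB α β (x, y)).2 - x =
      (α - β) * (x * (1 + x) / (β * (1 + x + y + α * x * y))) := by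
  have hD : 0 < 1 + x + y + α * x * y := by positivity
  simp only [quadrirationalYB]
  field_simp
  ring

lemma mul_betaKernel (γ : ℝ) (i j k : ℕ) (x : ℝ) :
    x * betaKernel γ i j k x = betaKernel γ (i + 1) j k x := by
  unfold betaKernel; rw [pow_succ']; ring

namespace IndepPreserving

variable {α β : ℝ} {μ ν ρ σ : Measure ℝ} [IsProbabilityMeasure μ] [IsProbabilityMeasure ν]
  [IsProbabilityMeasure ρ] [IsProbabilityMeasure σ]

/-- Under any tilt of the joint law by a preserved product, the variables `X` and `V` have
different means, because `V - X` has the sign of `α - β` everywhere. -/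
lemma betaMoment_ratio_ne (H : IndepPreserving α β μ ν ρ σ) (hα : 0 < α) (hβ : 0 < β)
    (hαβ : α ≠ β) {i j k l : ℕ} (hk : i + 1 ≤ j + k) (h : i + l = j + k) :
    betaMoment α μ (i + 1) j k * betaMoment β σ i j k ≠
      betaMoment α μ i j k * betaMoment β σ (i + 1) j k := by
  intro heq
  set F : ℝ × ℝ → ℝ := fun p => betaKernel α (i + 1) j k p.1 * betaKernel β j i l p.2 with hF
  set G : ℝ × ℝ → ℝ := fun p => betaKernel α j i l (quadrirationalYB α β p).1 *
    betaKernel β (i + 1) j k (quadrirationalYB α β p).2 with hG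
  have hFi : Integrable F (μ.prod ν) :=
    (integrable_betaKernel hα H.pos_μ hk).mul_prod
      (integrable_betaKernel hβ H.pos_ν (i := j) (j := i) (k := l) (by omega))
  have hGi : Integrable G (μ.prod ν) := by
    have : Integrable (fun p : ℝ × ℝ => betaKernel α j i l p.1 * betaKernel β (i + 1) j k p.2)
        ((μ.prod ν).map (quadrirationalYB α β)) := by
      rw [H.map_eq]
      exact (integrable_betaKernel hα H.pos_ρ (by omega)).mul_prod
        (integrable_betaKernel hβ H.pos_σ hk)
    exact this.comp_measurable (measurable_quadrirationalYB α β)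
  have hFint : ∫ p, F p ∂μ.prod ν = betaMoment α μ (i + 1) j k * betaMoment β ν j i l :=
    integral_prod_mul _ _
  have hGint : ∫ p, G p ∂μ.prod ν = betaMoment α ρ j i l * betaMoment β σ (i + 1) j k :=
    H.integral_prod_mul_comp (measurable_betaKernel α j i l) (measurable_betaKernel β (i + 1) j k)
  have hpos : 0 < ∫ p, (α - β) * (α ^ j * β ^ i * G p - α ^ i * β ^ j * F p) ∂μ.prod ν := by
    refine integral_pos_of_ae_pos
      (((hGi.const_mul _).sub (hFi.const_mul _)).const_mul _) ?_
    filter_upwards [H.ae_prod_pos] with p hp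
    obtain ⟨x, y⟩ := p
    obtain ⟨hx, hy⟩ : 0 < x ∧ 0 < y := hp
    have e := betaKernel_mul_betaKernel hα hβ hx hy h
    have e' := quadrirationalYB_snd_sub hα hβ hx hy
    simp only [hF, hG, ← mul_betaKernel _ i]
    rw [show (α - β) * (α ^ j * β ^ i * (betaKernel α j i l (quadrirationalYB α β (x, y)).1 *
        ((quadrirationalYB α β (x, y)).2 * betaKernel β i j k (quadrirationalYB α β (x, y)).2)) -
        α ^ i * β ^ j * (x * betaKernel α i j k x * betaKernel β j i l y)) =
        (α - β) * ((quadrirationalYB α β (x, y)).2 - x) *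
        (α ^ i * β ^ j * (betaKernel α i j k x * betaKernel β j i l y)) by
          linear_combination (-(α - β) * (quadrirationalYB α β (x, y)).2) * e, e']
    have h1 := betaKernel_pos hα hx i j k
    have h2 := betaKernel_pos hβ hy j i l
    have h3 : 0 < (α - β) * (α - β) := mul_self_pos.2 (sub_ne_zero.2 hαβ)
    rw [← mul_assoc (α - β)]
    positivity
  rw [integral_const_mul, integral_sub (hGi.const_mul _) (hFi.const_mul _), integral_const_mul,
    integral_const_mul, hFint, hGint] at hpos
  have hm := H.betaMoment_mul hα hβ h
  have hV := betaMoment_pos hβ H.pos_σ (i := i) (j := j) (k := k) (by omega)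
  have : (α ^ j * β ^ i * (betaMoment α ρ j i l * betaMoment β σ (i + 1) j k) -
      α ^ i * β ^ j * (betaMoment α μ (i + 1) j k * betaMoment β ν j i l)) *
      betaMoment β σ i j k = 0 := by
    linear_combination (-α ^ i * β ^ j * betaMoment β ν j i l) * heq -
      betaMoment β σ (i + 1) j k * hm
  rw [(mul_eq_zero.1 this).resolve_right hV.ne'] at hpos
  simp at hpos

end IndepPreserving

/-- The ratio between a moment of `V` and the dual moment of `Y`. The subtraction is exact in the
range `i ≤ j + k` where the moments are finite. -/
noncomputable def momentRatio (β : ℝ) (σ ν : Measure ℝ) (i j k : ℕ) : ℝ :=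
  betaMoment β σ i j k / betaMoment β ν j i (j + k - i)

lemma momentRatio_pos {β : ℝ} {σ ν : Measure ℝ} [IsProbabilityMeasure σ] [IsProbabilityMeasure ν]
    (hβ : 0 < β) (hσ : ∀ᵐ v ∂σ, 0 < v) (hν : ∀ᵐ y ∂ν, 0 < y) {i j k : ℕ} (h : i ≤ j + k) :
    0 < momentRatio β σ ν i j k :=
  div_pos (betaMoment_pos hβ hσ h) (betaMoment_pos hβ hν (by omega))

lemma betaMoment_eq_momentRatio_mul {β : ℝ} {σ ν : Measure ℝ} [IsProbabilityMeasure ν]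
    (hβ : 0 < β) (hν : ∀ᵐ y ∂ν, 0 < y) {i j k l : ℕ} (h : i + l = j + k) :
    betaMoment β σ i j k = momentRatio β σ ν i j k * betaMoment β ν j i l := by
  have := betaMoment_pos hβ hν (i := j) (j := i) (k := l) (by omega)
  rw [momentRatio, show j + k - i = l by omega, div_mul_cancel₀ _ this.ne']

namespace IndepPreserving

variable {α β : ℝ} {μ ν ρ σ : Measure ℝ} [IsProbabilityMeasure μ] [IsProbabilityMeasure ν]
  [IsProbabilityMeasure ρ] [IsProbabilityMeasure σ]

/-- `N₂ N₁₃ = N₃ N₁₂` and `N₁ N₂₃ = N₃ N₁₂` for the moment ratio `N` on the hexagon with vertices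
`1 = (i+1, j+1, 1)`, `2 = (i, j, 1)`, `3 = (i, j+1, 0)`, `12 = (i+1, j, 1)`, `13 = (i+1, j+1, 0)`,
`23 = (i, j, 0)`. -/
lemma momentRatio_mul (H : IndepPreserving α β μ ν ρ σ) (hα : 0 < α) (hβ : 0 < β)
    (hαβ : α ≠ β) {i j : ℕ} (h : i ≤ j) :
    momentRatio β σ ν i j 1 * momentRatio β σ ν (i + 1) (j + 1) 0 =
        momentRatio β σ ν i (j + 1) 0 * momentRatio β σ ν (i + 1) j 1 ∧
      momentRatio β σ ν (i + 1) (j + 1) 1 * momentRatio β σ ν i j 0 =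
        momentRatio β σ ν i (j + 1) 0 * momentRatio β σ ν (i + 1) j 1 := by
  obtain ⟨d, rfl⟩ := Nat.exists_eq_add_of_le h
  unfold momentRatio
  rw [show i + d + 1 - i = d + 1 by omega, show i + d + 1 + 0 - (i + 1) = d by omega,
    show i + d + 1 + 1 - (i + 1) = d + 1 by omega, show i + d + 0 - i = d by omega]
  have V (i j k) (h : i ≤ j + k) := betaMoment_pos hβ H.pos_σ h
  have Y (i j k) (h : i ≤ j + k) := betaMoment_pos hβ H.pos_ν h
  have U (i j k) (h : i ≤ j + k) := betaMoment_pos hα H.pos_ρ h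
  -- the common factor `r` with `X = r V` and `U = r Y`, up to powers of `α / β`
  have R : ∀ i j k l : ℕ, i + l = j + k → ∃ r, betaMoment α μ i j k = r * betaMoment β σ i j k ∧
      α ^ j * β ^ i * betaMoment α ρ j i l = α ^ i * β ^ j * (r * betaMoment β ν j i l) := by
    intro i j k l hl
    have hV := V i j k (by omega)
    refine ⟨betaMoment α μ i j k / betaMoment β σ i j k, by field_simp, ?_⟩
    field_simp
    linear_combination -(H.betaMoment_mul hα hβ hl)
  obtain ⟨r₁, hX₁, hU₁⟩ := R (i + 1) (i + d + 1) 1 (d + 1) (by omega)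
  obtain ⟨r₂, hX₂, hU₂⟩ := R i (i + d) 1 (d + 1) (by omega)
  obtain ⟨r₃, hX₃, hU₃⟩ := R i (i + d + 1) 0 (d + 1) (by omega)
  obtain ⟨r₁₂, hX₁₂, hU₁₂⟩ := R (i + 1) (i + d) 1 d (by omega)
  obtain ⟨r₁₃, hX₁₃, hU₁₃⟩ := R (i + 1) (i + d + 1) 0 d (by omega)
  obtain ⟨r₂₃, hX₂₃, hU₂₃⟩ := R i (i + d) 0 d (by omega)
  have hr : r₃ - r₁₃ ≠ 0 := by
    intro h0
    refine H.betaMoment_ratio_ne hα hβ hαβ (i := i) (j := i + d + 1) (k := 0) (l := d + 1)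
      (by omega) (by omega) ?_
    rw [hX₁₃, hX₃]
    linear_combination -(betaMoment β σ (i + 1) (i + d + 1) 0 *
      betaMoment β σ i (i + d + 1) 0) * h0
  have hL : α ^ i * β ^ (i + d) ≠ 0 := by positivity
  have hU₁' := mul_left_cancel₀ (a := α * β)
    (b := α ^ (i + d) * β ^ i * betaMoment α ρ (i + d + 1) (i + 1) (d + 1))
    (c := α ^ i * β ^ (i + d) * (r₁ * betaMoment β ν (i + d + 1) (i + 1) (d + 1)))
    (by positivity) (by linear_combination hU₁)
  have hU₁₃' := mul_left_cancel₀ (a := α * β)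
    (b := α ^ (i + d) * β ^ i * betaMoment α ρ (i + d + 1) (i + 1) d)
    (c := α ^ i * β ^ (i + d) * (r₁₃ * betaMoment β ν (i + d + 1) (i + 1) d))
    (by positivity) (by linear_combination hU₁₃)
  have key := hexagon_relations (α := α) hβ (V (i + 1) (i + d) 1 (by omega))
    (V (i + 1) (i + d + 1) 0 (by omega)) (V i (i + d) 0 (by omega))
    (Y (i + d + 1) (i + 1) (d + 1) (by omega)) (Y (i + d + 1) i (d + 1) (by omega))
    (y₂ := betaMoment β ν (i + d) i (d + 1)) (y₁₂ := betaMoment β ν (i + d) (i + 1) d)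
    (y₁₃ := betaMoment β ν (i + d + 1) (i + 1) d) (y₂₃ := betaMoment β ν (i + d) i d)
    (V₁ := betaMoment β σ (i + 1) (i + d + 1) 1) (V₂ := betaMoment β σ i (i + d) 1)
    (V₃ := betaMoment β σ i (i + d + 1) 0)
    (r₁ := r₁) (r₂ := r₂) (r₃ := r₃) (r₁₂ := r₁₂) (r₁₃ := r₁₃) (r₂₃ := r₂₃)
    (by linear_combination betaMoment_succ hβ H.pos_σ (i := i + 1) (j := i + d) (k := 0) (by omega))
    (betaMoment_eq_add_mul hβ H.pos_σ (i := i) (j := i + d) (k := 0) (by omega))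
    (betaMoment_eq_add hβ H.pos_σ (i := i) (j := i + d) (k := 0) (by omega))
    (by rw [← hX₁, ← hX₁₂, ← hX₁₃]
        linear_combination betaMoment_succ hα H.pos_μ (i := i + 1) (j := i + d) (k := 0) (by omega))
    (by rw [← hX₂, ← hX₁₂, ← hX₂₃]; exact betaMoment_eq_add_mul hα H.pos_μ (i := i) (j := i + d) (k := 0) (by omega))
    (by rw [← hX₃, ← hX₁₃, ← hX₂₃]; exact betaMoment_eq_add hα H.pos_μ (i := i) (j := i + d) (k := 0) (by omega))
    (by linear_combination betaMoment_succ hβ H.pos_ν (i := i + d) (j := i) (k := d) (by omega) -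
          (1 - β) * betaMoment_eq_add hβ H.pos_ν (i := i + d) (j := i) (k := d + 1) (by omega))
    (by linear_combination betaMoment_succ hβ H.pos_ν (i := i + d + 1) (j := i) (k := d) (by omega))
    (betaMoment_eq_add_mul hβ H.pos_ν (i := i + d) (j := i) (k := d) (by omega))
    (mul_left_cancel₀ hL (by
      linear_combination -hU₁₂ + β * hU₂ + β * (α - 1) * hU₁' + α ^ (i + d) * β ^ i * β *
        (betaMoment_succ hα H.pos_ρ (i := i + d) (j := i) (k := d) (by omega) -
          (1 - α) * betaMoment_eq_add hα H.pos_ρ (i := i + d) (j := i) (k := d + 1) (by omega))))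
    (mul_left_cancel₀ hL (by
      linear_combination -hU₁₃' + hU₃ + (1 - α) * hU₁' + α ^ (i + d) * β ^ i *
        betaMoment_succ hα H.pos_ρ (i := i + d + 1) (j := i) (k := d) (by omega)))
    (mul_left_cancel₀ hL (by
      linear_combination -hU₂₃ + hU₂ + hU₃ + α ^ (i + d) * β ^ i *
        betaMoment_eq_add_mul hα H.pos_ρ (i := i + d) (j := i) (k := d) (by omega))) hr
  have h1 := V (i + 1) (i + d) 1 (by omega)
  have h2 := V i (i + d + 1) 0 (by omega)
  have h3 := Y (i + d) i (d + 1) (by omega)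
  have h4 := Y (i + d + 1) i (d + 1) (by omega)
  have h5 := Y (i + d) (i + 1) d (by omega)
  have h6 := Y (i + d + 1) (i + 1) d (by omega)
  have h7 := Y (i + d + 1) (i + 1) (d + 1) (by omega)
  have h8 := Y (i + d) i d (by omega)
  constructor
  · field_simp
    linear_combination key.1
  · field_simp
    linear_combination key.2

/-! ### Contiguous relations -/

/-- The moment ratio also relates the moments of `X` and `U`, up to a power of `α / β`. -/
lemma pow_mul_betaMoment_eq (H : IndepPreserving α β μ ν ρ σ) (hα : 0 < α) (hβ : 0 < β) {i j k l : ℕ}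
    (h : i + l = j + k) : α ^ i * β ^ j * betaMoment α μ i j k =
      α ^ j * β ^ i * (momentRatio β σ ν i j k * betaMoment α ρ j i l) := by
  have := betaMoment_pos hβ H.pos_ν (i := j) (j := i) (k := l) (by omega)
  refine mul_right_cancel₀ this.ne' ?_
  linear_combination H.betaMoment_mul hα hβ h +
    α ^ j * β ^ i * betaMoment α ρ j i l * betaMoment_eq_momentRatio_mul hβ H.pos_ν (σ := σ) h

/-- The four laws satisfy three-term contiguous relations with common coefficients `c`, `b`. For each
law the relation is one of the elementary linear relations for the dual law, multiplied
by the moment ratio. -/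
lemma contiguous (H : IndepPreserving α β μ ν ρ σ) (hα : 0 < α) (hβ : 0 < β)
    (hαβ : α ≠ β) {i j d : ℕ} (h : i + d = j) {c b : ℝ}
    (hc : c = momentRatio β σ ν (i + 1) (j + 1) 1 / momentRatio β σ ν i (j + 1) 0)
    (hb : b = momentRatio β σ ν i j 1 / momentRatio β σ ν i (j + 1) 0) :
    (c * betaMoment β σ i j 0 = b * betaMoment β σ (i + 1) (j + 1) 0 +
        betaMoment β σ (i + 1) j 1) ∧
      (β * c * betaMoment α μ i j 0 = β * b * betaMoment α μ (i + 1) (j + 1) 0 +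
        α * betaMoment α μ (i + 1) j 1) ∧
      ((β - 1) * c * betaMoment β ν (j + 1) (i + 1) (d + 1) + b * betaMoment β ν j i (d + 1) =
        betaMoment β ν (j + 1) i (d + 1)) ∧
      β * ((α - 1) * c * betaMoment α ρ (j + 1) (i + 1) (d + 1) +
        b * betaMoment α ρ j i (d + 1)) = α * betaMoment α ρ (j + 1) i (d + 1) := by
  have hN := momentRatio_pos hβ H.pos_σ H.pos_ν (i := i) (j := j + 1) (k := 0) (by omega)
  obtain ⟨m₁, m₂⟩ := H.momentRatio_mul hα hβ hαβ (i := i) (j := j) (by omega)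
  have n₁ : b * momentRatio β σ ν (i + 1) (j + 1) 0 = momentRatio β σ ν (i + 1) j 1 := by
    rw [hb]; field_simp; linear_combination m₁
  have n₂ : c * momentRatio β σ ν i j 0 = momentRatio β σ ν (i + 1) j 1 := by
    rw [hc]; field_simp; linear_combination m₂
  have n₃ : c * momentRatio β σ ν i (j + 1) 0 = momentRatio β σ ν (i + 1) (j + 1) 1 := by
    rw [hc]; field_simp
  have n₄ : b * momentRatio β σ ν i (j + 1) 0 = momentRatio β σ ν i j 1 := by
    rw [hb]; field_simp
  have hL : α ^ i * β ^ j ≠ 0 := by positivity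
  have hK : α ^ j * β ^ i ≠ 0 := by positivity
  refine ⟨?_, ?_, ?_, ?_⟩
  · rw [betaMoment_eq_momentRatio_mul hβ H.pos_ν (σ := σ) (k := 0) (l := d) h,
      betaMoment_eq_momentRatio_mul hβ H.pos_ν (σ := σ) (i := i + 1) (j := j + 1) (k := 0) (l := d) (by omega),
      betaMoment_eq_momentRatio_mul hβ H.pos_ν (σ := σ) (i := i + 1) (j := j) (k := 1) (l := d) (by omega)]
    linear_combination betaMoment β ν j i d * n₂ - betaMoment β ν (j + 1) (i + 1) d * n₁ +
      momentRatio β σ ν (i + 1) j 1 * betaMoment_eq_add hβ H.pos_ν (i := j) (j := i) (k := d)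
        (by omega)
  · have e₁ := H.pow_mul_betaMoment_eq hα hβ (k := 0) (l := d) h
    have e₂ := H.pow_mul_betaMoment_eq hα hβ (i := i + 1) (j := j + 1) (k := 0) (l := d) (by omega)
    have e₃ := H.pow_mul_betaMoment_eq hα hβ (i := i + 1) (j := j) (k := 1) (l := d) (by omega)
    have e₂' := mul_left_cancel₀ (a := α * β)
      (b := α ^ i * β ^ j * betaMoment α μ (i + 1) (j + 1) 0)
      (c := α ^ j * β ^ i * (momentRatio β σ ν (i + 1) (j + 1) 0 *
        betaMoment α ρ (j + 1) (i + 1) d)) (by positivity) (by linear_combination e₂)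
    refine mul_left_cancel₀ hL ?_
    linear_combination β * c * e₁ - β * b * e₂' - e₃ + α ^ j * β ^ i * β *
      (betaMoment α ρ j i d * n₂ - betaMoment α ρ (j + 1) (i + 1) d * n₁ +
        momentRatio β σ ν (i + 1) j 1 * betaMoment_eq_add hα H.pos_ρ (i := j) (j := i) (k := d)
        (by omega))
  · refine mul_left_cancel₀ hN.ne' ?_
    have e₁ := betaMoment_eq_momentRatio_mul hβ H.pos_ν (σ := σ) (i := i + 1) (j := j + 1) (k := 1) (l := d + 1) (by omega)
    have e₂ := betaMoment_eq_momentRatio_mul hβ H.pos_ν (σ := σ) (i := i) (j := j) (k := 1) (l := d + 1) (by omega)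
    have e₃ := betaMoment_eq_momentRatio_mul hβ H.pos_ν (σ := σ) (i := i) (j := j + 1) (k := 0) (l := d + 1) (by omega)
    linear_combination (β - 1) * betaMoment β ν (j + 1) (i + 1) (d + 1) * n₃ +
      betaMoment β ν j i (d + 1) * n₄ - (β - 1) * e₁ - e₂ + e₃ +
      betaMoment_eq_add hβ H.pos_σ (i := i) (j := j) (k := 1) (by omega) -
      betaMoment_eq_add_mul hβ H.pos_σ (i := i) (j := j + 1) (k := 0) (by omega)
  · refine mul_left_cancel₀ (mul_ne_zero hK hN.ne') ?_
    have e₁ := H.pow_mul_betaMoment_eq hα hβ (i := i + 1) (j := j + 1) (k := 1) (l := d + 1) (by omega)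
    have e₁' := mul_left_cancel₀ (a := α * β)
      (b := α ^ i * β ^ j * betaMoment α μ (i + 1) (j + 1) 1)
      (c := α ^ j * β ^ i * (momentRatio β σ ν (i + 1) (j + 1) 1 *
        betaMoment α ρ (j + 1) (i + 1) (d + 1))) (by positivity) (by linear_combination e₁)
    have e₂ := H.pow_mul_betaMoment_eq hα hβ (i := i) (j := j) (k := 1) (l := d + 1) (by omega)
    have e₃ := H.pow_mul_betaMoment_eq hα hβ (i := i) (j := j + 1) (k := 0) (l := d + 1) (by omega)
    linear_combination α ^ j * β ^ i * β * ((α - 1) * betaMoment α ρ (j + 1) (i + 1) (d + 1) * n₃ +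
      betaMoment α ρ j i (d + 1) * n₄) - β * (α - 1) * e₁' - β * e₂ + e₃ +
      α ^ i * β ^ j * β * (betaMoment_eq_add hα H.pos_μ (i := i) (j := j) (k := 1) (by omega) -
      betaMoment_eq_add_mul hα H.pos_μ (i := i) (j := j + 1) (k := 0) (by omega))

/-- The coefficient `c` depends only on `i` and `b` only on `j`, and the contiguous relations at
`(i, j)`, `(i + 1, j)` and `(i, j - 1)` show that their increments agree, so both are affine
with the same slope. The slope is nonnegative since `c` stays positive. -/
lemma exists_contiguous (H : IndepPreserving α β μ ν ρ σ) (hα : 0 < α) (hβ : 0 < β)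
    (hαβ : α ≠ β) : ∃ c b t : ℝ, 0 < c ∧ 0 < b ∧ 0 ≤ t ∧ c < b + 1 / β ∧ ∀ n : ℕ,
      ((c + t * n) * betaMoment β σ n n 0 =
        (b + t * n) * betaMoment β σ (n + 1) (n + 1) 0 + betaMoment β σ (n + 1) n 1) ∧
      (β * (c + t * n) * betaMoment α μ n n 0 =
        β * (b + t * n) * betaMoment α μ (n + 1) (n + 1) 0 + α * betaMoment α μ (n + 1) n 1) ∧
      ((β - 1) * (c + t * n) * betaMoment β ν (n + 1) (n + 1) 1 +
        (b + t * n) * betaMoment β ν n n 1 = betaMoment β ν (n + 1) n 1) ∧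
      β * ((α - 1) * (c + t * n) * betaMoment α ρ (n + 1) (n + 1) 1 +
        (b + t * n) * betaMoment α ρ n n 1) = α * betaMoment α ρ (n + 1) n 1 := by
  set N := momentRatio β σ ν with hN
  obtain ⟨c, hc⟩ : ∃ c : ℕ → ℕ → ℝ, ∀ i j, c i j = N (i + 1) (j + 1) 1 / N i (j + 1) 0 :=
    ⟨_, fun _ _ => rfl⟩
  obtain ⟨b, hb⟩ : ∃ b : ℕ → ℕ → ℝ, ∀ i j, b i j = N i j 1 / N i (j + 1) 0 :=
    ⟨_, fun _ _ => rfl⟩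
  have Npos {i j k : ℕ} (h : i ≤ j + k) : 0 < N i j k := momentRatio_pos hβ H.pos_σ H.pos_ν h
  have Vpos {i j k : ℕ} (h : i ≤ j + k) : 0 < betaMoment β σ i j k := betaMoment_pos hβ H.pos_σ h
  have rel {i j d : ℕ} (h : i + d = j) := H.contiguous hα hβ hαβ h (hc i j) (hb i j)
  have hcj {i j : ℕ} (h : i ≤ j) : c i j = c i i := by
    induction j, h using Nat.le_induction with
    | base => rfl
    | succ j hij ih =>
      rw [← ih, hc, hc]
      have := (H.momentRatio_mul hα hβ hαβ (i := i) (j := j + 1) (by omega)).2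
      have h1 := Npos (i := i) (j := j + 1) (k := 0) (by omega)
      have h2 := Npos (i := i) (j := j + 1 + 1) (k := 0) (by omega)
      rw [div_eq_div_iff h2.ne' h1.ne']
      linear_combination this
  have hbi {i j : ℕ} (h : i ≤ j) : b i j = b j j := by
    induction h using Nat.decreasingInduction with
    | self => rfl
    | of_succ i hij ih =>
      rw [← ih, hb, hb]
      have := (H.momentRatio_mul hα hβ hαβ (i := i) (j := j) (by omega)).1
      have h1 := Npos (i := i) (j := j + 1) (k := 0) (by omega)
      have h2 := Npos (i := i + 1) (j := j + 1) (k := 0) (by omega)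
      rw [div_eq_div_iff h1.ne' h2.ne']
      linear_combination this
  have hinc {i j : ℕ} (h : i ≤ j) : c (i + 1) (i + 1) - c i i = b (j + 1) (j + 1) - b j j := by
    obtain ⟨d, rfl⟩ := Nat.exists_eq_add_of_le h
    have r₁ := (rel (i := i) (j := i + d + 1) (d := d + 1) (by omega)).1
    have r₂ := (rel (i := i + 1) (j := i + d + 1) (d := d) (by omega)).1
    have r₃ := (rel (i := i) (j := i + d) (d := d) (by omega)).1
    rw [hcj (by omega), hbi (by omega)] at r₁ r₂ r₃
    have V := Vpos (i := i + 1) (j := i + d + 1) (k := 0) (by omega)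
    -- express every moment in the three relations through those at `(i+1, j+1, 0)`, `(i+1, j, 1)`
    have s₁ := betaMoment_eq_add hβ H.pos_σ (i := i + 1) (j := i + d + 1) (k := 0) (by omega)
    have s₂ := betaMoment_eq_add_mul hβ H.pos_σ (i := i + 1) (j := i + d + 1) (k := 0) (by omega)
    have s₃ := betaMoment_eq_add hβ H.pos_σ (i := i) (j := i + d) (k := 0) (by omega)
    have s₄ := betaMoment_succ hβ H.pos_σ (i := i + 1) (j := i + d) (k := 0) (by omega)
    refine mul_right_cancel₀ (mul_pos hβ V).ne' ?_
    linear_combination β * r₂ - β * r₃ + β * r₁ - β * b (i + d + 1) (i + d + 1) * s₁ - s₂ +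
      s₄ + β * c i i * s₃
  have hct (n : ℕ) : c n n = c 0 0 + (c 1 1 - c 0 0) * n := by
    induction n with
    | zero => simp
    | succ n ih =>
      have h1 := hinc (le_refl n)
      have h2 := hinc (Nat.zero_le n)
      push_cast
      linear_combination ih + h1 - h2
  have hbt (n : ℕ) : b n n = b 0 0 + (c 1 1 - c 0 0) * n := by
    induction n with
    | zero => simp
    | succ n ih =>
      have h2 := hinc (Nat.zero_le n)
      push_cast
      linear_combination ih - h2
  have cpos (n : ℕ) : 0 < c n n := by
    rw [hc]; exact div_pos (Npos (by omega)) (Npos (by omega))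
  have bpos : 0 < b 0 0 := by rw [hb]; exact div_pos (Npos (by omega)) (Npos (by omega))
  refine ⟨c 0 0, b 0 0, c 1 1 - c 0 0, cpos 0, bpos, ?_, ?_, fun n => ?_⟩
  · by_contra! hneg
    obtain ⟨n, hn⟩ := exists_nat_gt (c 0 0 / -(c 1 1 - c 0 0))
    have h := cpos n
    rw [hct n] at h
    rw [div_lt_iff₀ (by linarith)] at hn
    linarith
  · have r := (rel (i := 0) (j := 0) (d := 0) rfl).1
    have s₁ := betaMoment_eq_add hβ H.pos_σ (i := 0) (j := 0) (k := 0) (by omega)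
    have s₂ := betaMoment_eq_add_mul hβ H.pos_σ (i := 0) (j := 0) (k := 0) (by omega)
    have V₁ := Vpos (i := 0) (j := 1) (k := 0) (by omega)
    have V₂ := Vpos (i := 0) (j := 0) (k := 1) (by omega)
    have V := Vpos (i := 0) (j := 0) (k := 0) (by omega)
    refine lt_of_mul_lt_mul_right ?_ V.le
    simp only [zero_add] at *
    have : betaMoment β σ 1 0 1 < 1 / β * betaMoment β σ 0 0 0 := by
      rw [s₂, mul_add, ← mul_assoc, one_div, inv_mul_cancel₀ hβ.ne', one_mul]
      have : 0 < β⁻¹ * betaMoment β σ 0 0 1 := by positivity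
      linarith
    have : b 0 0 * betaMoment β σ 1 1 0 < b 0 0 * betaMoment β σ 0 0 0 := by
      gcongr; linarith
    linarith
  · rw [← hct, ← hbt]
    exact rel (d := 0) rfl

end IndepPreserving

/-! ### A Stein identity for second kind beta weights -/

open Filter Topology

/-- The function `Q` with `x w'(x) + w(x) = Q(x) w(x)` for the weight `w = betaWeight γ A B D`. -/
noncomputable def steinCoeff (γ A B D x : ℝ) : ℝ :=
  A - B * (x / (1 + x)) - D * (γ * x / (1 + γ * x))

/-- The weight `x^(A-1) (1 + γ x)^(-D) (1 + x)^(-B)`, an unnormalised `GB_II` density. -/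
noncomputable def betaWeight (γ A B D x : ℝ) : ℝ :=
  x ^ (A - 1) / ((1 + γ * x) ^ D * (1 + x) ^ B)

lemma betaWeight_pos {γ A B D x : ℝ} (hγ : 0 < γ) (hx : 0 < x) : 0 < betaWeight γ A B D x := by
  unfold betaWeight; positivity

lemma measurable_steinCoeff (γ A B D : ℝ) : Measurable (steinCoeff γ A B D) := by
  unfold steinCoeff; fun_prop

lemma measurable_betaWeight (γ A B D : ℝ) : Measurable (betaWeight γ A B D) := by
  unfold betaWeight; fun_prop

lemma abs_steinCoeff_le {γ A B D x : ℝ} (hγ : 0 < γ) (hx : 0 < x) :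
    |steinCoeff γ A B D x| ≤ |A| + |B| + |D| := by
  have h1 : |x / (1 + x)| ≤ 1 := by
    rw [abs_of_pos (by positivity), div_le_one (by positivity)]; linarith
  have h2 : |γ * x / (1 + γ * x)| ≤ 1 := by
    rw [abs_of_pos (by positivity), div_le_one (by positivity)]; linarith
  unfold steinCoeff
  refine (abs_sub _ _).trans (add_le_add ((abs_sub _ _).trans (add_le_add le_rfl ?_)) ?_)
  · rw [abs_mul]; exact mul_le_of_le_one_right (abs_nonneg _) h1
  · rw [abs_mul]; exact mul_le_of_le_one_right (abs_nonneg _) h2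

lemma hasDerivAt_mul_betaWeight {γ A B D x : ℝ} (hγ : 0 < γ) (hx : 0 < x) :
    HasDerivAt (fun x => x * betaWeight γ A B D x)
      (betaWeight γ A B D x * steinCoeff γ A B D x) x := by
  have h1 : 0 < 1 + x := by positivity
  have h2 : 0 < 1 + γ * x := by positivity
  have d1 := ((hasDerivAt_id x).const_add 1).rpow_const (p := B) (Or.inl h1.ne')
  have d2 := (((hasDerivAt_id x).const_mul γ).const_add 1).rpow_const (p := D) (Or.inl h2.ne')
  have d3 := (hasDerivAt_id x).rpow_const (p := A - 1) (Or.inl hx.ne')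
  have d4 := (hasDerivAt_id x).mul (d3.div (d2.mul d1)
    (mul_pos (Real.rpow_pos_of_pos h2 _) (Real.rpow_pos_of_pos h1 _)).ne')
  refine d4.congr_deriv ?_
  simp only [id, betaWeight, steinCoeff, Pi.mul_apply, Pi.div_apply]
  rw [Real.rpow_sub_one hx.ne' (A - 1), Real.rpow_sub_one h1.ne' B, Real.rpow_sub_one h2.ne' D]
  have := Real.rpow_pos_of_pos hx (A - 1)
  have := Real.rpow_pos_of_pos h1 B
  have := Real.rpow_pos_of_pos h2 D
  field_simp
  ring

section Stein

variable {γ A B D : ℝ} {μ : Measure ℝ} [IsProbabilityMeasure μ]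

lemma unit_mem {x : ℝ} (hx : 0 < x) : x / (1 + x) ∈ Icc (0 : ℝ) 1 :=
  ⟨by positivity, (div_le_one (by positivity)).2 (by linarith)⟩

lemma abs_integral_unit_le {φ : ℝ → ℝ} {ε x : ℝ} (hφ : ∀ s ∈ Icc (0 : ℝ) 1, |φ s| ≤ ε)
    (hx : 0 < x) : |∫ s in (0 : ℝ)..(x / (1 + x)), φ s| ≤ ε := by
  have hs := unit_mem hx
  have := intervalIntegral.norm_integral_le_of_norm_le_const (a := 0) (b := x / (1 + x)) (f := φ)
    (C := ε) (fun s hs' => by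
      rw [uIoc_of_le hs.1] at hs'
      exact hφ s ⟨hs'.1.le, hs'.2.trans hs.2⟩)
  rw [Real.norm_eq_abs, sub_zero, abs_of_nonneg hs.1] at this
  refine this.trans (mul_le_of_le_one_right ?_ hs.2)
  exact (abs_nonneg _).trans (hφ 0 ⟨le_rfl, zero_le_one⟩)

/-- The Stein operator `g ↦ x g' + Q g` applied to `g(x) = ∫₀^s φ`, where `s = x / (1 + x)`; note that
`x ds/dx = s (1 - s)`. -/
noncomputable def steinIntegrand (γ A B D : ℝ) (φ : ℝ → ℝ) (x : ℝ) : ℝ :=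
  x / (1 + x) * (1 - x / (1 + x)) * φ (x / (1 + x)) +
    steinCoeff γ A B D x * ∫ s in (0 : ℝ)..(x / (1 + x)), φ s

lemma steinIntegrand_add {φ ψ : ℝ → ℝ} (hφ : Continuous φ) (hψ : Continuous ψ) (x : ℝ) :
    steinIntegrand γ A B D (fun s => φ s + ψ s) x =
      steinIntegrand γ A B D φ x + steinIntegrand γ A B D ψ x := by
  unfold steinIntegrand
  rw [intervalIntegral.integral_add (hφ.intervalIntegrable _ _) (hψ.intervalIntegrable _ _)]
  ring

lemma steinIntegrand_sub {φ ψ : ℝ → ℝ} (hφ : Continuous φ) (hψ : Continuous ψ) (x : ℝ) :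
    steinIntegrand γ A B D (fun s => φ s - ψ s) x =
      steinIntegrand γ A B D φ x - steinIntegrand γ A B D ψ x := by
  unfold steinIntegrand
  rw [intervalIntegral.integral_sub (hφ.intervalIntegrable _ _) (hψ.intervalIntegrable _ _)]
  ring

lemma abs_steinIntegrand_le (hγ : 0 < γ) {φ : ℝ → ℝ} {ε x : ℝ}
    (hφ : ∀ s ∈ Icc (0 : ℝ) 1, |φ s| ≤ ε) (hx : 0 < x) :
    |steinIntegrand γ A B D φ x| ≤ (1 + (|A| + |B| + |D|)) * ε := by
  have hs := unit_mem hx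
  have hε : 0 ≤ ε := (abs_nonneg _).trans (hφ 0 ⟨le_rfl, zero_le_one⟩)
  have h1 : |x / (1 + x) * (1 - x / (1 + x))| ≤ 1 := by
    rw [abs_of_nonneg (mul_nonneg hs.1 (sub_nonneg.2 hs.2))]
    nlinarith [hs.1, hs.2]
  refine (abs_add_le _ _).trans ?_
  rw [abs_mul _ (φ _), abs_mul (steinCoeff γ A B D x), add_mul]
  exact add_le_add (mul_le_mul h1 (hφ _ hs) (abs_nonneg _) zero_le_one)
    (mul_le_mul (abs_steinCoeff_le hγ hx) (abs_integral_unit_le hφ hx) (abs_nonneg _)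
      (by positivity))

lemma measurable_steinIntegrand {φ : ℝ → ℝ} (hφ : Continuous φ) :
    Measurable (steinIntegrand γ A B D φ) := by
  have h1 : Measurable fun x : ℝ => x / (1 + x) := by fun_prop
  have h2 : Continuous fun y => ∫ s in (0 : ℝ)..y, φ s :=
    intervalIntegral.continuous_primitive (fun a b => hφ.intervalIntegrable a b) 0
  exact ((h1.mul (measurable_const.sub h1)).mul (hφ.measurable.comp h1)).add
    ((measurable_steinCoeff γ A B D).mul (h2.measurable.comp h1))

lemma integrable_steinIntegrand (hγ : 0 < γ) (hμ : ∀ᵐ x ∂μ, 0 < x) {φ : ℝ → ℝ}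
    (hφ : Continuous φ) : Integrable (steinIntegrand γ A B D φ) μ := by
  obtain ⟨C, hC⟩ := isCompact_Icc.exists_bound_of_continuousOn (hφ.continuousOn (s := Icc 0 1))
  refine Integrable.of_bound (measurable_steinIntegrand hφ).aestronglyMeasurable
    ((1 + (|A| + |B| + |D|)) * C) ?_
  filter_upwards [hμ] with x hx
  exact abs_steinIntegrand_le hγ hC hx

lemma integral_steinIntegrand_polynomial (hγ : 0 < γ) (hμ : ∀ᵐ x ∂μ, 0 < x)
    (h : ∀ n : ℕ, ∫ x, (x / (1 + x)) ^ n * (n * (1 - x / (1 + x)) + steinCoeff γ A B D x) ∂μ = 0)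
    (p : Polynomial ℝ) : ∫ x, steinIntegrand γ A B D (fun s => p.eval s) x ∂μ = 0 := by
  induction p using Polynomial.induction_on' with
  | add p q hp hq =>
    simp only [Polynomial.eval_add, steinIntegrand_add p.continuous q.continuous]
    rw [integral_add (integrable_steinIntegrand hγ hμ p.continuous)
      (integrable_steinIntegrand hγ hμ q.continuous), hp, hq, add_zero]
  | monomial n a =>
    have hn : (n : ℝ) + 1 ≠ 0 := by positivity
    have e (x : ℝ) : steinIntegrand γ A B D (fun s => (Polynomial.monomial n a).eval s) x =
        a / (n + 1) * ((x / (1 + x)) ^ (n + 1) *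
          ((n + 1 : ℕ) * (1 - x / (1 + x)) + steinCoeff γ A B D x)) := by
      simp only [Polynomial.eval_monomial, steinIntegrand]
      rw [intervalIntegral.integral_const_mul, integral_pow, zero_pow (by omega), sub_zero]
      generalize x / (1 + x) = s
      push_cast
      field_simp
      ring
    simp only [e]
    rw [integral_const_mul, h, mul_zero]

/-- The Stein identity on powers of `x / (1 + x)` extends to all test functions with a continuous
derivative, by Weierstrass approximation of the derivative. -/
lemma integral_steinIntegrand_eq_zero (hγ : 0 < γ) (hμ : ∀ᵐ x ∂μ, 0 < x)
    (h : ∀ n : ℕ, ∫ x, (x / (1 + x)) ^ n * (n * (1 - x / (1 + x)) + steinCoeff γ A B D x) ∂μ = 0)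
    {φ : ℝ → ℝ} (hφ : Continuous φ) : ∫ x, steinIntegrand γ A B D φ x ∂μ = 0 := by
  by_contra hne
  obtain ⟨K, hK⟩ : ∃ K, K = 1 + (|A| + |B| + |D|) := ⟨_, rfl⟩
  have hKpos : 0 < K := by rw [hK]; positivity
  obtain ⟨T, hT⟩ : ∃ T, T = ∫ x, steinIntegrand γ A B D φ x ∂μ := ⟨_, rfl⟩
  have hTpos : 0 < |T| := abs_pos.2 (hT ▸ hne)
  obtain ⟨p, hp⟩ := exists_polynomial_near_of_continuousOn 0 1 φ hφ.continuousOn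
    (|T| / (2 * K)) (by positivity)
  have key : T = ∫ x, steinIntegrand γ A B D (fun s => φ s - p.eval s) x ∂μ := by
    simp only [steinIntegrand_sub hφ p.continuous]
    rw [integral_sub (integrable_steinIntegrand hγ hμ hφ)
      (integrable_steinIntegrand hγ hμ p.continuous),
      integral_steinIntegrand_polynomial hγ hμ h p, sub_zero, hT]
  have hle : |T| ≤ K * (|T| / (2 * K)) := by
    calc |T| = ‖∫ x, steinIntegrand γ A B D (fun s => φ s - p.eval s) x ∂μ‖ := by
          rw [← key, Real.norm_eq_abs]
      _ ≤ K * (|T| / (2 * K)) * μ.real univ := by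
          refine norm_integral_le_of_norm_le_const ?_
          filter_upwards [hμ] with x hx
          rw [hK]
          refine abs_steinIntegrand_le hγ (fun s hs => ?_) hx
          rw [abs_sub_comm, ← hK]
          exact (hp s hs).le
      _ = _ := by simp
  have : K * (|T| / (2 * K)) = |T| / 2 := by field_simp
  linarith

end Stein

lemma continuousAt_betaWeight {γ A B D x : ℝ} (hγ : 0 < γ) (hx : 0 < x) :
    ContinuousAt (betaWeight γ A B D) x := by
  have h1 : 0 < 1 + x := by positivity
  have h2 : 0 < 1 + γ * x := by positivity
  unfold betaWeight
  refine ContinuousAt.div (continuousAt_id.rpow_const (Or.inl hx.ne'))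
    (((continuousAt_const.add (continuousAt_const.mul continuousAt_id)).rpow_const
      (Or.inl h2.ne')).mul ((continuousAt_const.add continuousAt_id).rpow_const (Or.inl h1.ne')))
    (by positivity)

lemma continuousAt_steinCoeff {γ A B D x : ℝ} (hγ : 0 < γ) (hx : 0 < x) :
    ContinuousAt (steinCoeff γ A B D) x := by
  have h1 : 1 + x ≠ 0 := by positivity
  have h2 : 1 + γ * x ≠ 0 := by positivity
  unfold steinCoeff
  fun_prop (disch := assumption)

lemma continuous_of_continuousAt_Ioi {f : ℝ → ℝ} {a : ℝ} (ha : 0 < a) (h0 : ∀ x ≤ a, f x = 0)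
    (h : ∀ x, 0 < x → ContinuousAt f x) : Continuous f := by
  refine continuous_iff_continuousAt.2 fun x => ?_
  rcases lt_or_ge x a with hx | hx
  · refine (continuousAt_const (y := (0 : ℝ))).congr ?_
    filter_upwards [Iio_mem_nhds hx] with y hy
    exact (h0 y (le_of_lt hy)).symm
  · exact h x (ha.trans_le hx)

/-- At `s = 1` the argument `s / (1 - s)` is `0` by convention, where `ψ` vanishes. -/
lemma continuous_comp_unit {ψ : ℝ → ℝ} {a b : ℝ} (hψ : Continuous ψ) (ha : 0 < a)
    (h0 : ∀ x ≤ a, ψ x = 0) (h1 : ∀ x, b ≤ x → ψ x = 0) :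
    Continuous fun s => ψ (s / (1 - s)) := by
  refine continuous_iff_continuousAt.2 fun s => ?_
  rcases eq_or_ne s 1 with rfl | hs
  · refine (continuousAt_const (y := (0 : ℝ))).congr ?_
    obtain ⟨c, hc, hbc⟩ : ∃ c, 0 < c ∧ b ≤ c := ⟨max b 1, by positivity, le_max_left _ _⟩
    have hlt : c / (1 + c) < 1 := (div_lt_one (by positivity)).2 (by linarith)
    filter_upwards [Ioi_mem_nhds hlt] with y hy
    rcases lt_or_ge y 1 with h | h
    · rw [h1]
      refine hbc.trans ?_
      rw [mem_Ioi, div_lt_iff₀ (by positivity)] at hy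
      rw [le_div_iff₀ (by linarith)]
      nlinarith
    · rw [h0]
      refine le_trans ?_ ha.le
      exact div_nonpos_of_nonneg_of_nonpos (by linarith) (by linarith)
  · have : 1 - s ≠ 0 := sub_ne_zero.2 hs.symm
    exact hψ.continuousAt.comp (by fun_prop (disch := assumption))

section Stein

variable {γ A B D : ℝ} {μ : Measure ℝ} [IsProbabilityMeasure μ]

/-- If `h` is continuous with compact support in `(0, ∞)` and `∫ h w = 0`, then
`g(x) = (∫_a^x h w) / (x w(x))` has compact support in `(0, ∞)` and solves `x g' + Q g = h`, so that
the Stein identity for `g` reads `∫ h dμ = 0`. -/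
lemma integral_eq_zero_of_integral_mul_betaWeight_eq_zero (hγ : 0 < γ) (hμ : ∀ᵐ x ∂μ, 0 < x)
    (H : ∀ n : ℕ, ∫ x, (x / (1 + x)) ^ n * (n * (1 - x / (1 + x)) + steinCoeff γ A B D x) ∂μ = 0)
    {h : ℝ → ℝ} (hc : Continuous h) {a b : ℝ} (ha : 0 < a) (h0 : ∀ x ≤ a, h x = 0)
    (h1 : ∀ x, b ≤ x → h x = 0) (hint : ∫ x, h x * betaWeight γ A B D x = 0) :
    ∫ x, h x ∂μ = 0 := by
  set w := betaWeight γ A B D with hw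
  set Q := steinCoeff γ A B D with hQ
  have hwpos {x : ℝ} (hx : 0 < x) : 0 < w x := betaWeight_pos hγ hx
  have he : Continuous fun x => h x * w x :=
    continuous_of_continuousAt_Ioi ha (fun x hx => by rw [h0 x hx, zero_mul])
      fun x hx => hc.continuousAt.mul (continuousAt_betaWeight hγ hx)
  set I : ℝ → ℝ := fun x => ∫ t in a..x, h t * w t with hI
  have hI' (x : ℝ) : HasDerivAt I (h x * w x) x := (he.integral_hasStrictDerivAt a x).hasDerivAt
  have hI0 {x : ℝ} (hx : x ≤ a) : I x = 0 := by
    rw [hI]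
    refine (intervalIntegral.integral_congr (g := fun _ => 0) fun t ht => ?_).trans (by simp)
    rw [uIcc_of_ge hx] at ht
    simp [h0 t ht.2]
  have hI1 {x : ℝ} (hx : b ≤ x) : I x = 0 := by
    rw [← hint, hI]
    refine intervalIntegral.integral_eq_integral_of_support_subset fun t ht => ?_
    by_contra hcon
    refine ht ?_
    rw [mem_Ioc, not_and_or, not_lt, not_le] at hcon
    rcases hcon with hcon | hcon
    · simp [h0 t hcon]
    · simp [h1 t (hx.trans hcon.le)]
  set g : ℝ → ℝ := fun x => I x / (x * w x) with hg
  have hg' {x : ℝ} (hx : 0 < x) : HasDerivAt g ((h x - Q x * g x) / x) x := by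
    have := (hI' x).div (hasDerivAt_mul_betaWeight hγ hx) (mul_pos hx (hwpos hx)).ne'
    refine this.congr_deriv ?_
    have := hwpos hx
    rw [hg, ← hw, ← hQ]
    field_simp
  set ψ : ℝ → ℝ := fun x => (1 + x) ^ 2 * ((h x - Q x * g x) / x) with hψ
  have hψ0 (x : ℝ) (hx : x ≤ a) : ψ x = 0 := by simp [hψ, hg, h0 x hx, hI0 hx]
  have hψ1 (x : ℝ) (hx : b ≤ x) : ψ x = 0 := by simp [hψ, hg, h1 x hx, hI1 hx]
  have hψc : Continuous ψ := by
    refine continuous_of_continuousAt_Ioi ha hψ0 fun x hx => ?_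
    refine ContinuousAt.mul (by fun_prop) (ContinuousAt.div ?_ continuousAt_id hx.ne')
    exact hc.continuousAt.sub ((continuousAt_steinCoeff hγ hx).mul (hg' hx).continuousAt)
  have hφ := continuous_comp_unit hψc ha hψ0 hψ1
  have hs {x : ℝ} (hx : 0 < x) : x / (1 + x) / (1 - x / (1 + x)) = x := by
    have : 1 + x ≠ 0 := by positivity
    field_simp
    ring
  have hJ {x : ℝ} (hx : 0 < x) :
      HasDerivAt (fun x => ∫ s in (0 : ℝ)..(x / (1 + x)), ψ (s / (1 - s)))
        ((h x - Q x * g x) / x) x := by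
    have hx1 : 1 + x ≠ 0 := by positivity
    have d1 : HasDerivAt (fun x : ℝ => x / (1 + x)) (1 / (1 + x) ^ 2) x := by
      refine ((hasDerivAt_id x).div ((hasDerivAt_id x).const_add 1) hx1).congr_deriv ?_
      simp
    have d2 := (hφ.integral_hasStrictDerivAt 0 (x / (1 + x))).hasDerivAt.comp x d1
    refine d2.congr_deriv ?_
    rw [hs hx, hψ]
    field_simp
  have hJg : EqOn (fun x => ∫ s in (0 : ℝ)..(x / (1 + x)), ψ (s / (1 - s))) g (Ioi 0) := by
    refine isOpen_Ioi.eqOn_of_deriv_eq isPreconnected_Ioi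
      (fun x hx => (hJ hx).differentiableAt.differentiableWithinAt)
      (fun x hx => (hg' hx).differentiableAt.differentiableWithinAt)
      (fun x hx => (hJ hx).deriv.trans (hg' hx).deriv.symm) (x := a) ha ?_
    have hga : g a = 0 := by simp [hg, hI0 le_rfl]
    have hsa : 0 ≤ a / (1 + a) := by positivity
    simp only [hga]
    refine (intervalIntegral.integral_congr (g := fun _ => 0) fun t ht => ?_).trans (by simp)
    rw [uIcc_of_le hsa] at ht
    refine hψ0 _ ?_
    have h1a : a / (1 + a) < 1 := (div_lt_one (by positivity)).2 (by linarith)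
    have ht2 := ht.2
    rw [le_div_iff₀ (by positivity)] at ht2
    rw [div_le_iff₀ (by linarith [ht.2])]
    linarith
  rw [← integral_steinIntegrand_eq_zero hγ hμ H hφ]
  refine integral_congr_ae ?_
  filter_upwards [hμ] with x hx
  have e := hJg hx
  simp only at e
  rw [steinIntegrand, e, hs hx, hψ, ← hQ]
  field_simp
  ring

end Stein

/-! ### Uniqueness in the Stein identity -/

/-- Continuous functions with compact support in `(0, ∞)`, increasing to its indicator function. -/
noncomputable def cutoff (n : ℕ) (x : ℝ) : ℝ :=
  max 0 (min 1 (min ((n + 2) * x - 1) (n + 2 - x)))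

lemma continuous_cutoff (n : ℕ) : Continuous (cutoff n) := by
  unfold cutoff; fun_prop

lemma cutoff_nonneg (n : ℕ) (x : ℝ) : 0 ≤ cutoff n x := le_max_left _ _

lemma cutoff_le_one (n : ℕ) (x : ℝ) : cutoff n x ≤ 1 := max_le zero_le_one (min_le_left _ _)

lemma cutoff_of_le {n : ℕ} {x : ℝ} (hx : x ≤ 1 / (n + 2)) : cutoff n x = 0 := by
  rw [le_div_iff₀ (by positivity)] at hx
  exact max_eq_left ((min_le_right _ _).trans ((min_le_left _ _).trans (by linarith)))

lemma cutoff_of_ge {n : ℕ} {x : ℝ} (hx : (n : ℝ) + 2 ≤ x) : cutoff n x = 0 :=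
  max_eq_left ((min_le_right _ _).trans ((min_le_right _ _).trans (by linarith)))

lemma monotone_cutoff {x : ℝ} (hx : 0 < x) : Monotone fun n => cutoff n x := by
  intro m n hmn
  have : (m : ℝ) ≤ n := by exact_mod_cast hmn
  unfold cutoff
  simp only
  gcongr

lemma tendsto_cutoff {x : ℝ} (hx : 0 < x) : Tendsto (fun n => cutoff n x) atTop (𝓝 1) := by
  refine tendsto_const_nhds.congr' ?_
  obtain ⟨N, hN⟩ := exists_nat_ge (max (2 / x) x)
  filter_upwards [eventually_ge_atTop N] with n hn
  have hn' : max (2 / x) x ≤ n := hN.trans (by exact_mod_cast hn)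
  have h1 := (le_max_left _ _).trans hn'
  have h2 := (le_max_right _ _).trans hn'
  rw [div_le_iff₀ hx] at h1
  rw [cutoff, min_eq_left (le_min (by nlinarith) (by linarith)), max_eq_right zero_le_one]

section Stein

variable {γ A B D : ℝ} {μ : Measure ℝ} [IsProbabilityMeasure μ]

lemma continuous_mul_betaWeight (hγ : 0 < γ) {h : ℝ → ℝ} (hc : Continuous h) {a : ℝ} (ha : 0 < a)
    (h0 : ∀ x ≤ a, h x = 0) : Continuous fun x => h x * betaWeight γ A B D x :=
  continuous_of_continuousAt_Ioi ha (fun x hx => by rw [h0 x hx, zero_mul])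
    fun _ hx => hc.continuousAt.mul (continuousAt_betaWeight hγ hx)

lemma hasCompactSupport_mul {h w : ℝ → ℝ} {a b : ℝ} (h0 : ∀ x ≤ a, h x = 0)
    (h1 : ∀ x, b ≤ x → h x = 0) : HasCompactSupport fun x => h x * w x := by
  refine HasCompactSupport.intro (isCompact_Icc (a := a) (b := b)) fun x hx => ?_
  rw [mem_Icc, not_and_or, not_le, not_le] at hx
  rcases hx with hx | hx
  · rw [h0 x hx.le, zero_mul]
  · rw [h1 x hx.le, zero_mul]

lemma integral_cutoff_mul_betaWeight_pos (hγ : 0 < γ) :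
    0 < ∫ x, cutoff 0 x * betaWeight γ A B D x := by
  have h2 : (0 : ℝ) < 1 / ((0 : ℕ) + 2) := by positivity
  refine (continuous_mul_betaWeight hγ (continuous_cutoff 0) h2
    fun x hx => cutoff_of_le hx).integral_pos_of_hasCompactSupport_nonneg_nonzero
    (hasCompactSupport_mul (fun x hx => cutoff_of_le hx) fun x hx => cutoff_of_ge hx)
    (fun x => ?_) (x := 1) ?_
  · rcases le_or_gt x (1 / ((0 : ℕ) + 2)) with hx | hx
    · simp [cutoff_of_le hx]
    · exact mul_nonneg (cutoff_nonneg _ _) (betaWeight_pos hγ (h2.trans hx)).le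
  · have : cutoff 0 1 = 1 := by norm_num [cutoff]
    rw [this, one_mul]
    exact (betaWeight_pos hγ one_pos).ne'

lemma exists_integral_eq_mul_integral_betaWeight (hγ : 0 < γ) (hμ : ∀ᵐ x ∂μ, 0 < x)
    (H : ∀ n : ℕ, ∫ x, (x / (1 + x)) ^ n * (n * (1 - x / (1 + x)) + steinCoeff γ A B D x) ∂μ = 0) :
    ∃ c : ℝ, 0 ≤ c ∧ ∀ (h : ℝ → ℝ) (a b : ℝ), Continuous h → 0 < a → (∀ x ≤ a, h x = 0) →
      (∀ x, b ≤ x → h x = 0) → ∫ x, h x ∂μ = c * ∫ x, h x * betaWeight γ A B D x := by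
  have hκ := integral_cutoff_mul_betaWeight_pos (γ := γ) (A := A) (B := B) (D := D) hγ
  set κ := ∫ x, cutoff 0 x * betaWeight γ A B D x with hκdef
  refine ⟨(∫ x, cutoff 0 x ∂μ) / κ, div_nonneg (integral_nonneg fun x => cutoff_nonneg 0 x) hκ.le,
    fun h a b hc ha h0 h1 => ?_⟩
  set r := (∫ x, h x * betaWeight γ A B D x) / κ with hr
  have h2 : (0 : ℝ) < 1 / ((0 : ℕ) + 2) := by positivity
  have i1 : Integrable fun x => h x * betaWeight γ A B D x :=
    (continuous_mul_betaWeight hγ hc ha h0).integrable_of_hasCompactSupport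
      (hasCompactSupport_mul h0 h1)
  have i2 : Integrable fun x => cutoff 0 x * betaWeight γ A B D x :=
    (continuous_mul_betaWeight hγ (continuous_cutoff 0) h2
      fun x hx => cutoff_of_le hx).integrable_of_hasCompactSupport
      (hasCompactSupport_mul (fun x hx => cutoff_of_le hx) fun x hx => cutoff_of_ge hx)
  have i3 : Integrable h μ := by
    have := (hasCompactSupport_mul (w := fun _ => 1) h0 h1)
    simp only [mul_one] at this
    exact hc.integrable_of_hasCompactSupport this
  have i4 : Integrable (cutoff 0) μ :=
    Integrable.of_bound (continuous_cutoff 0).aestronglyMeasurable 1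
      (Eventually.of_forall fun x => by
        rw [Real.norm_of_nonneg (cutoff_nonneg 0 x)]; exact cutoff_le_one 0 x)
  have key := integral_eq_zero_of_integral_mul_betaWeight_eq_zero hγ hμ H
    (h := fun x => h x - r * cutoff 0 x) (a := min a (1 / ((0 : ℕ) + 2)))
    (b := max b ((0 : ℕ) + 2)) (hc.sub (continuous_const.mul (continuous_cutoff 0)))
    (lt_min ha h2)
    (fun x hx => by
      rw [h0 x (hx.trans (min_le_left _ _)), cutoff_of_le (hx.trans (min_le_right _ _))]; simp)
    (fun x hx => by
      rw [h1 x ((le_max_left _ _).trans hx), cutoff_of_ge ((le_max_right _ _).trans hx)]; simp)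
    (by
      simp only [sub_mul, mul_assoc]
      rw [integral_sub i1 (i2.const_mul r), integral_const_mul, ← hκdef, hr]
      field_simp
      ring)
  rw [integral_sub i3 (i4.const_mul r), integral_const_mul, sub_eq_zero] at key
  rw [key, hr]
  ring

/-- A law on `(0, ∞)` satisfying the Stein identity of a second kind beta weight on the powers of
`x / (1 + x)` is that weight, normalised. Integrability of the weight is part of the
conclusion, as the law has total mass one. -/
lemma eq_withDensity_betaWeight (hγ : 0 < γ) (hμ : ∀ᵐ x ∂μ, 0 < x)
    (H : ∀ n : ℕ, ∫ x, (x / (1 + x)) ^ n * (n * (1 - x / (1 + x)) + steinCoeff γ A B D x) ∂μ = 0) :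
    μ = volume.withDensity fun x => ENNReal.ofReal ((Ioi (0 : ℝ)).indicator
      (fun x => 1 / (∫ x in Ioi (0 : ℝ), betaWeight γ A B D x) * betaWeight γ A B D x) x) := by
  obtain ⟨c, hc, hint⟩ := exists_integral_eq_mul_integral_betaWeight hγ hμ H
  set w := betaWeight γ A B D with hw
  have hpos (n : ℕ) : (0 : ℝ) < 1 / (n + 2) := by positivity
  have hnn (n : ℕ) (x : ℝ) : 0 ≤ cutoff n x * (c * w x) := by
    rcases le_or_gt x (1 / (n + 2)) with hx | hx
    · simp [cutoff_of_le hx]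
    · exact mul_nonneg (cutoff_nonneg _ _)
        (mul_nonneg hc (betaWeight_pos hγ ((hpos n).trans hx)).le)
  have hwm : Measurable w := measurable_betaWeight γ A B D
  have hcm (n : ℕ) : Measurable (cutoff n) := (continuous_cutoff n).measurable
  have hwn (n : ℕ) : Measurable fun x => cutoff n x * (c * w x) := (hcm n).mul (hwm.const_mul c)
  have hfin (n : ℕ) : IsFiniteMeasure
      (volume.withDensity fun x => ENNReal.ofReal (cutoff n x * (c * w x))) := by
    refine isFiniteMeasure_withDensity_ofReal (Integrable.hasFiniteIntegral ?_)
    have := ((continuous_mul_betaWeight (A := A) (B := B) (D := D) hγ (continuous_cutoff n) (hpos n)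
      fun x hx => cutoff_of_le hx).integrable_of_hasCompactSupport
      (μ := volume)
      (hasCompactSupport_mul (fun x hx => cutoff_of_le hx) fun x hx => cutoff_of_ge hx)).const_mul c
    exact this.congr (Eventually.of_forall fun x => by simp only [hw]; ring)
  have hfin' (n : ℕ) : IsFiniteMeasure (μ.withDensity fun x => ENNReal.ofReal (cutoff n x)) := by
    refine isFiniteMeasure_withDensity_ofReal (Integrable.hasFiniteIntegral ?_)
    exact Integrable.of_bound (continuous_cutoff n).aestronglyMeasurable 1
      (Eventually.of_forall fun x => by
        rw [Real.norm_of_nonneg (cutoff_nonneg n x)]; exact cutoff_le_one n x)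
  have hn (n : ℕ) : μ.withDensity (fun x => ENNReal.ofReal (cutoff n x)) =
      volume.withDensity fun x => ENNReal.ofReal (cutoff n x * (c * w x)) := by
    refine ext_of_forall_integral_eq_of_IsFiniteMeasure fun f => ?_
    rw [integral_withDensity_eq_integral_toReal_smul (hcm n).ennreal_ofReal (by simp),
      integral_withDensity_eq_integral_toReal_smul
        (hwn n).ennreal_ofReal (by simp)]
    simp only [smul_eq_mul, ENNReal.toReal_ofReal (cutoff_nonneg n _),
      ENNReal.toReal_ofReal (hnn n _)]
    rw [hint (fun x => cutoff n x * f x) (1 / (n + 2)) (n + 2)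
      ((continuous_cutoff n).mul f.continuous) (hpos n)
      (fun x hx => by rw [cutoff_of_le hx, zero_mul])
      (fun x hx => by rw [cutoff_of_ge hx, zero_mul]), ← integral_const_mul]
    refine integral_congr_ae (Eventually.of_forall fun x => ?_)
    simp only
    ring
  -- let the cutoffs increase to the indicator function of `(0, ∞)`
  have hμc : μ = volume.withDensity fun x => ENNReal.ofReal ((Ioi (0 : ℝ)).indicator
      (fun x => c * w x) x) := by
    ext s hs
    have t1 : Tendsto (fun n => ∫⁻ x in s, ENNReal.ofReal (cutoff n x) ∂μ) atTop
        (𝓝 (∫⁻ _ in s, 1 ∂μ)) := by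
      refine lintegral_tendsto_of_tendsto_of_monotone
        (fun n => (hcm n).ennreal_ofReal.aemeasurable) ?_ ?_
      · filter_upwards [ae_restrict_of_ae hμ] with x hx m n hmn
        exact ENNReal.ofReal_le_ofReal (monotone_cutoff hx hmn)
      · filter_upwards [ae_restrict_of_ae hμ] with x hx
        rw [← ENNReal.ofReal_one]
        exact ENNReal.tendsto_ofReal (tendsto_cutoff hx)
    have t2 : Tendsto (fun n => ∫⁻ x in s, ENNReal.ofReal (cutoff n x * (c * w x))) atTop
        (𝓝 (∫⁻ x in s, ENNReal.ofReal ((Ioi (0 : ℝ)).indicator (fun x => c * w x) x))) := by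
      refine lintegral_tendsto_of_tendsto_of_monotone
        (fun n => (hwn n).ennreal_ofReal.aemeasurable)
        (Eventually.of_forall fun x m n hmn => ?_) (Eventually.of_forall fun x => ?_)
      · rcases le_or_gt x 0 with hx | hx
        · simp [cutoff_of_le (hx.trans (hpos _).le)]
        · exact ENNReal.ofReal_le_ofReal (mul_le_mul_of_nonneg_right (monotone_cutoff hx hmn)
            (mul_nonneg hc (betaWeight_pos hγ hx).le))
      · refine ENNReal.tendsto_ofReal ?_
        rcases le_or_gt x 0 with hx | hx
        · rw [indicator_of_notMem (by simpa using hx)]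
          simp [cutoff_of_le (hx.trans (hpos _).le)]
        · rw [indicator_of_mem (mem_Ioi.2 hx)]
          simpa using (tendsto_cutoff hx).mul_const (c * w x)
    have e (n : ℕ) : ∫⁻ x in s, ENNReal.ofReal (cutoff n x) ∂μ =
        ∫⁻ x in s, ENNReal.ofReal (cutoff n x * (c * w x)) := by
      rw [← withDensity_apply _ hs, hn n, withDensity_apply _ hs]
    simp only [e] at t1
    rw [withDensity_apply _ hs, ← tendsto_nhds_unique t1 t2]
    simp
  -- the total mass of `μ` determines the constant
  have hmass : c * ∫ x in Ioi (0 : ℝ), w x = 1 := by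
    rw [← integral_const_mul, ← integral_indicator measurableSet_Ioi,
      integral_eq_lintegral_of_nonneg_ae]
    · rw [← setLIntegral_univ, ← withDensity_apply _ MeasurableSet.univ, ← hμc, measure_univ]
      simp
    · exact Eventually.of_forall fun x => indicator_nonneg
        (fun y hy => mul_nonneg hc (betaWeight_pos hγ hy).le) x
    · exact ((hwm.const_mul c).indicator measurableSet_Ioi).aestronglyMeasurable
  rw [← eq_one_div_of_mul_eq_one_left hmass]
  exact hμc

end Stein

/-! ### Identification of the laws -/

lemma image_unit_Ioi : (fun x : ℝ => x / (1 + x)) '' Ioi 0 = Ioo 0 1 := by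
  ext t
  constructor
  · rintro ⟨x, hx, rfl⟩
    rw [mem_Ioi] at hx
    exact ⟨by positivity, (div_lt_one (by positivity)).2 (by linarith)⟩
  · rintro ⟨h0, h1⟩
    have : 1 - t ≠ 0 := by linarith
    refine ⟨t / (1 - t), div_pos h0 (by linarith), ?_⟩
    field_simp
    ring

lemma injOn_unit : InjOn (fun x : ℝ => x / (1 + x)) (Ioi 0) := by
  intro x hx y hy h
  rw [mem_Ioi] at hx hy
  simp only at h
  rw [div_eq_div_iff (by positivity) (by positivity)] at h
  linarith

/-- Euler's integral after the substitution `t = x / (1 + x)`. -/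
lemma setIntegral_betaWeight {p q ν γ : ℝ} (hγ : 0 < γ) (hq : 0 < q + ν) (hp : 0 < p - ν) :
    ∫ x in Ioi (0 : ℝ), betaWeight γ (q + ν) (q - ν) (p + ν) x =
      beta (q + ν) (p - ν) * gaussHypergeometric (p + ν) (q + ν) (p + q) (1 - γ) := by
  have hb := beta_pos hq hp
  rw [gaussHypergeometric, show p + q - (q + ν) = p - ν by ring, ← mul_assoc, mul_one_div,
    div_self hb.ne', one_mul, intervalIntegral.integral_of_le zero_le_one,
    integral_Ioc_eq_integral_Ioo, ← image_unit_Ioi,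
    integral_image_eq_integral_abs_deriv_smul measurableSet_Ioi
      (f' := fun x => 1 / (1 + x) ^ 2) (fun x hx => ?_) injOn_unit]
  · refine setIntegral_congr_fun measurableSet_Ioi fun x hx => ?_
    rw [mem_Ioi] at hx
    have h1 : 0 < 1 + x := by positivity
    have h2 : 0 < 1 + γ * x := by positivity
    have e1 : 1 - x / (1 + x) = (1 + x)⁻¹ := by field_simp; ring
    have e2 : 1 - (1 - γ) * (x / (1 + x)) = (1 + γ * x) / (1 + x) := by field_simp; ring
    simp only [smul_eq_mul]
    rw [e1, e2, abs_of_pos (by positivity), Real.div_rpow hx.le h1.le,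
      Real.div_rpow h2.le h1.le, Real.inv_rpow h1.le, betaWeight, Real.rpow_neg h2.le (p + ν),
      Real.rpow_neg h1.le (p + ν)]
    have e3 : (1 + x) ^ (p + ν) = (1 + x) ^ (2 : ℕ) * (1 + x) ^ (q + ν - 1) *
        (1 + x) ^ (p - ν - 1) / (1 + x) ^ (q - ν) := by
      rw [← Real.rpow_natCast, ← Real.rpow_add h1, ← Real.rpow_add h1, ← Real.rpow_sub h1]
      congr 1
      push_cast
      ring
    rw [e3]
    have := Real.rpow_pos_of_pos h1 (q - ν)
    have := Real.rpow_pos_of_pos h1 (p - ν - 1)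
    have := Real.rpow_pos_of_pos h1 (q + ν - 1)
    have := Real.rpow_pos_of_pos h2 (p + ν)
    field_simp
  · rw [mem_Ioi] at hx
    have hx1 : 1 + x ≠ 0 := by positivity
    refine (((hasDerivAt_id x).div ((hasDerivAt_id x).const_add 1) hx1).congr_deriv
      ?_).hasDerivWithinAt
    simp

lemma eq_gbIIMeasure {p q ν γ : ℝ} {μ : Measure ℝ} [IsProbabilityMeasure μ] (hγ : 0 < γ)
    (hq : 0 < q + ν) (hp : 0 < p - ν) (hμ : ∀ᵐ x ∂μ, 0 < x)
    (H : ∀ n : ℕ, ∫ x, (x / (1 + x)) ^ n *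
      (n * (1 - x / (1 + x)) + steinCoeff γ (q + ν) (q - ν) (p + ν) x) ∂μ = 0) :
    μ = gbIIMeasure ν p q γ := by
  rw [eq_withDensity_betaWeight hγ hμ H, setIntegral_betaWeight hγ hq hp]
  rfl

/-- The contiguous relations of the laws of `X` and `V` are the Stein identity of a `GB_II` law. -/
lemma eq_gbIIMeasure_of_betaMoment {p q ν γ c b t k : ℝ} {μ : Measure ℝ}
    [IsProbabilityMeasure μ] (hγ : 0 < γ) (hμ : ∀ᵐ x ∂μ, 0 < x) (ht : 0 < t)
    (hq : 0 < q + ν) (hp : 0 < p - ν) (hc : c = t * (q + ν)) (hb : b = t * (q - ν))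
    (hk : k = t * (γ * (p + ν)))
    (H : ∀ n : ℕ, (c + t * n) * betaMoment γ μ n n 0 =
      (b + t * n) * betaMoment γ μ (n + 1) (n + 1) 0 + k * betaMoment γ μ (n + 1) n 1) :
    μ = gbIIMeasure ν p q γ := by
  refine eq_gbIIMeasure hγ hq hp hμ fun n => ?_
  have i1 := integrable_betaKernel hγ hμ (i := n) (j := n) (k := 0) (by omega)
  have i2 := integrable_betaKernel hγ hμ (i := n + 1) (j := n + 1) (k := 0) (by omega)
  have i3 := integrable_betaKernel hγ hμ (i := n + 1) (j := n) (k := 1) (by omega)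
  refine mul_left_cancel₀ ht.ne' ?_
  rw [mul_zero, ← sub_eq_zero.2 (H n), betaMoment, betaMoment, betaMoment, ← integral_const_mul,
    ← integral_const_mul, ← integral_const_mul, ← integral_const_mul,
    ← integral_add (i2.const_mul _) (i3.const_mul _),
    ← integral_sub (i1.const_mul _) ((i2.const_mul _).fun_add (i3.const_mul _))]
  refine integral_congr_ae ?_
  filter_upwards [hμ] with x hx
  have h1 : 0 < 1 + x := by positivity
  have h2 : 0 < 1 + γ * x := by positivity
  simp only [betaKernel, steinCoeff, hc, hb, hk, div_pow, pow_succ, pow_zero, mul_one, one_mul]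
  field_simp
  ring

/-- The contiguous relations of the laws of `Y` and `U` are the Stein identity of a `GB_II` law. -/
lemma eq_gbIIMeasure_of_betaMoment_dual {p q ν γ c b t k : ℝ} {μ : Measure ℝ}
    [IsProbabilityMeasure μ] (hγ : 0 < γ) (hμ : ∀ᵐ x ∂μ, 0 < x) (ht : 0 < t)
    (hq : 0 < q + ν) (hp : 0 < p - ν) (hb : b = t * (q + ν)) (hc : c = t * (q - ν))
    (hk : k = t * (γ * (p - ν)))
    (H : ∀ n : ℕ, (γ - 1) * (c + t * n) * betaMoment γ μ (n + 1) (n + 1) 1 +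
      (b + t * n) * betaMoment γ μ n n 1 = k * betaMoment γ μ (n + 1) n 1) :
    μ = gbIIMeasure ν p q γ := by
  refine eq_gbIIMeasure hγ hq hp hμ fun n => ?_
  have i1 := integrable_betaKernel hγ hμ (i := n + 1) (j := n + 1) (k := 1) (by omega)
  have i2 := integrable_betaKernel hγ hμ (i := n) (j := n) (k := 1) (by omega)
  have i3 := integrable_betaKernel hγ hμ (i := n + 1) (j := n) (k := 1) (by omega)
  refine mul_left_cancel₀ ht.ne' ?_
  rw [mul_zero, ← sub_eq_zero.2 (H n), betaMoment, betaMoment, betaMoment, ← integral_const_mul,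
    ← integral_const_mul, ← integral_const_mul, ← integral_const_mul,
    ← integral_add (i1.const_mul _) (i2.const_mul _),
    ← integral_sub ((i1.const_mul _).fun_add (i2.const_mul _)) (i3.const_mul _)]
  refine integral_congr_ae ?_
  filter_upwards [hμ] with x hx
  have h1 : 0 < 1 + x := by positivity
  have h2 : 0 < 1 + γ * x := by positivity
  simp only [betaKernel, steinCoeff, hc, hb, hk, div_pow, pow_succ, pow_zero, one_mul]
  field_simp
  ring

lemma exists_lt_of_ae {μ : Measure ℝ} [IsProbabilityMeasure μ] (hμ : ∀ c, μ ≠ Measure.dirac c)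
    {p : ℝ → Prop} (hp : ∀ᵐ x ∂μ, p x) : ∃ x₁ x₂, x₁ < x₂ ∧ p x₁ ∧ p x₂ := by
  by_contra! hcon
  obtain ⟨x₀, hx₀⟩ := hp.exists
  refine hμ x₀ ?_
  have : (id : ℝ → ℝ) =ᵐ[μ] fun _ => x₀ := by
    filter_upwards [hp] with x hx
    rcases lt_trichotomy x x₀ with h | h | h
    · exact absurd hx₀ (hcon x x₀ h hx)
    · exact h
    · exact absurd hx (hcon x₀ x h hx₀)
  rw [← Measure.map_id (μ := μ), Measure.map_congr this, Measure.map_const, measure_univ, one_smul]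

lemma quadrirationalYB_snd_lt {α β x₁ x₂ y : ℝ} (hα : 0 < α) (hβ : 0 < β) (hx₁ : 0 < x₁)
    (hy : 0 < y) (h : x₁ < x₂) :
    (quadrirationalYB α β (x₁, y)).2 < (quadrirationalYB α β (x₂, y)).2 := by
  have hx₂ := hx₁.trans h
  have h1 : 0 < 1 + x₁ + y + α * x₁ * y := by positivity
  have h2 : 0 < 1 + x₂ + y + α * x₂ * y := by positivity
  rw [← sub_pos]
  have : (quadrirationalYB α β (x₂, y)).2 - (quadrirationalYB α β (x₁, y)).2 =
      (x₂ - x₁) * ((α + β * y) * (1 + y) + α * (1 + β * y) * (1 + y) * (x₁ + x₂) +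
        α * (1 + β * y) * (1 + α * y) * x₁ * x₂) /
      (β * (1 + x₁ + y + α * x₁ * y) * (1 + x₂ + y + α * x₂ * y)) := by
    simp only [quadrirationalYB]
    field_simp
    ring
  rw [this]
  have := sub_pos.2 h
  positivity

lemma quadrirationalYB_snd_sub_snd {α β x y₁ y₂ : ℝ} (hα : 0 < α) (hβ : 0 < β) (hx : 0 < x)
    (hy₁ : 0 < y₁) (hy₂ : 0 < y₂) :
    (quadrirationalYB α β (x, y₂)).2 - (quadrirationalYB α β (x, y₁)).2 =
      (β - α) * (y₂ - y₁) * (x * (1 + x) * (1 + α * x) /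
      (β * (1 + x + y₁ + α * x * y₁) * (1 + x + y₂ + α * x * y₂))) := by
  have h1 : 0 < 1 + x + y₁ + α * x * y₁ := by positivity
  have h2 : 0 < 1 + x + y₂ + α * x * y₂ := by positivity
  simp only [quadrirationalYB]
  field_simp
  ring

lemma eq_zero_of_three_roots {c e f v₁ v₂ v₃ : ℝ} (h₁₂ : v₁ < v₂) (h₂₃ : v₂ < v₃)
    (h₁ : c + e * v₁ + f * v₁ ^ 2 = 0) (h₂ : c + e * v₂ + f * v₂ ^ 2 = 0)
    (h₃ : c + e * v₃ + f * v₃ ^ 2 = 0) : c = 0 := by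
  have a₁ : e + f * (v₁ + v₂) = 0 := by
    refine mul_left_cancel₀ (sub_pos.2 h₁₂).ne' ?_
    linear_combination h₂ - h₁
  have a₂ : e + f * (v₂ + v₃) = 0 := by
    refine mul_left_cancel₀ (sub_pos.2 h₂₃).ne' ?_
    linear_combination h₃ - h₂
  have hf : f = 0 := by
    refine mul_left_cancel₀ (sub_pos.2 (h₁₂.trans h₂₃)).ne' ?_
    linear_combination a₂ - a₁
  subst hf
  have he : e = 0 := by linarith
  subst he
  linarith

namespace IndepPreserving

variable {α β : ℝ} {μ ν ρ σ : Measure ℝ} [IsProbabilityMeasure μ] [IsProbabilityMeasure ν]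

/-- Two values of `X` and two values of `Y` produce at least three values of `V`, since `V` is strictly
increasing in `x` and strictly monotone in `y`. -/
lemma not_ae_quadratic [SFinite ρ] [SFinite σ] (H : IndepPreserving α β μ ν ρ σ)
    (hα : 0 < α) (hβ : 0 < β) (hαβ : α ≠ β)
    (hμ : ∀ c, μ ≠ Measure.dirac c) (hν : ∀ c, ν ≠ Measure.dirac c) {c e f : ℝ} (hc : c ≠ 0) :
    ¬ ∀ᵐ v ∂σ, c + e * v + f * v ^ 2 = 0 := by
  intro h
  have h' : ∀ᵐ p ∂(μ.prod ν).map (quadrirationalYB α β), c + e * p.2 + f * p.2 ^ 2 = 0 := by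
    rw [H.map_eq]
    exact Measure.quasiMeasurePreserving_snd.ae h
  have hF := ae_of_ae_map (measurable_quadrirationalYB α β).aemeasurable h'
  have hxy := Measure.ae_ae_of_ae_prod (hF.and H.ae_prod_pos)
  obtain ⟨x₁, x₂, hx, hx₁, hx₂⟩ := exists_lt_of_ae hμ hxy
  obtain ⟨y₁, y₂, hy, hy₁, hy₂⟩ := exists_lt_of_ae hν (hx₁.and hx₂)
  obtain ⟨⟨e₁₁, px₁, py₁⟩, e₂₁, px₂, -⟩ := hy₁
  obtain ⟨⟨e₁₂, -, py₂⟩, e₂₂, -, -⟩ := hy₂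
  simp only at px₁ px₂ py₁ py₂
  have hd := quadrirationalYB_snd_sub_snd hα hβ px₁ py₁ py₂
  have hpos : 0 < (y₂ - y₁) * (x₁ * (1 + x₁) * (1 + α * x₁) /
      (β * (1 + x₁ + y₁ + α * x₁ * y₁) * (1 + x₁ + y₂ + α * x₁ * y₂))) := by
    have := sub_pos.2 hy
    positivity
  rw [mul_assoc] at hd
  rcases lt_or_gt_of_ne hαβ with hlt | hgt
  · exact hc (eq_zero_of_three_roots
      (sub_pos.1 (hd ▸ mul_pos (sub_pos.2 hlt) hpos))
      (quadrirationalYB_snd_lt hα hβ px₁ py₂ hx) e₁₁ e₁₂ e₂₂)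
  · exact hc (eq_zero_of_three_roots
      (sub_neg.1 (hd ▸ mul_neg_of_neg_of_pos (sub_neg.2 hgt) hpos))
      (quadrirationalYB_snd_lt hα hβ px₁ py₁ hx) e₁₂ e₁₁ e₂₁)

/-- If the coefficients of the contiguous relation do not depend on `n`, the law is concentrated on
the zeros of a quadratic polynomial. -/
lemma ae_quadratic_of_contiguous [IsProbabilityMeasure σ] {β c b : ℝ} (hβ : 0 < β) (hσ : ∀ᵐ v ∂σ, 0 < v)
    (h : ∀ n : ℕ, c * betaMoment β σ n n 0 =
      b * betaMoment β σ (n + 1) (n + 1) 0 + betaMoment β σ (n + 1) n 1) :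
    ∀ᵐ v ∂σ, c + (c * (1 + β) - b - 1) * v + (c * β - b * β - 1) * v ^ 2 = 0 := by
  set R : ℝ → ℝ := fun v => c - b * (v / (1 + v)) - v / (1 + β * v) with hR
  have hn (n : ℕ) : Integrable (fun v => (v / (1 + v)) ^ n * R v) σ ∧
      ∫ v, (v / (1 + v)) ^ n * R v ∂σ = 0 := by
    have i1 := integrable_betaKernel hβ hσ (i := n) (j := n) (k := 0) (by omega)
    have i2 := integrable_betaKernel hβ hσ (i := n + 1) (j := n + 1) (k := 0) (by omega)
    have i3 := integrable_betaKernel hβ hσ (i := n + 1) (j := n) (k := 1) (by omega)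
    have e : (fun v => (v / (1 + v)) ^ n * R v) =ᵐ[σ] fun v => c * betaKernel β n n 0 v -
        (b * betaKernel β (n + 1) (n + 1) 0 v + betaKernel β (n + 1) n 1 v) := by
      filter_upwards [hσ] with v hv
      have h1 : 0 < 1 + v := by positivity
      have h2 : 0 < 1 + β * v := by positivity
      simp only [hR, betaKernel, div_pow, pow_succ, pow_zero, mul_one, one_mul]
      field_simp
      ring
    refine ⟨((i1.const_mul c).sub ((i2.const_mul b).add i3)).congr e.symm, ?_⟩
    rw [integral_congr_ae e, integral_sub (i1.const_mul _) ((i2.const_mul _).fun_add i3),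
      integral_add (i2.const_mul _) i3, integral_const_mul, integral_const_mul, sub_eq_zero]
    exact h n
  -- `R` is a quadratic polynomial in `v / (1 + v)` divided by `(1 + β v) / (1 + v)`
  have hsq : (fun v => (1 + β * v) / (1 + v) * R v ^ 2) =ᵐ[σ] fun v =>
      c * ((v / (1 + v)) ^ 0 * R v) + ((β - 1) * c - b - 1) * ((v / (1 + v)) ^ 1 * R v) +
        (-b * (β - 1)) * ((v / (1 + v)) ^ 2 * R v) := by
    filter_upwards [hσ] with v hv
    have h1 : 0 < 1 + v := by positivity
    have h2 : 0 < 1 + β * v := by positivity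
    have e : (1 + β * v) / (1 + v) * R v = c + ((β - 1) * c - b - 1) * (v / (1 + v)) +
        (-b * (β - 1)) * (v / (1 + v)) ^ 2 := by
      simp only [hR]
      field_simp
      ring
    linear_combination R v * e
  have i0 := (hn 0).1.const_mul c
  have i1 := (hn 1).1.const_mul ((β - 1) * c - b - 1)
  have i2 := (hn 2).1.const_mul (-b * (β - 1))
  have hint : Integrable (fun v => (1 + β * v) / (1 + v) * R v ^ 2) σ :=
    ((i0.add i1).add i2).congr hsq.symm
  have hz : ∫ v, (1 + β * v) / (1 + v) * R v ^ 2 ∂σ = 0 := by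
    rw [integral_congr_ae hsq, integral_add (i0.fun_add i1) i2, integral_add i0 i1,
      integral_const_mul, integral_const_mul, integral_const_mul, (hn 0).2, (hn 1).2, (hn 2).2]
    simp
  rw [integral_eq_zero_iff_of_nonneg_ae (hσ.mono fun v hv => by
    simp only [Pi.zero_apply]; positivity) hint] at hz
  filter_upwards [hz, hσ] with v hv hv0
  have h1 : 0 < 1 + v := by positivity
  have h2 : 0 < 1 + β * v := by positivity
  have hRv : R v = 0 := by
    simpa [h1.ne', h2.ne'] using hv
  simp only [hR] at hRv
  field_simp at hRv
  linear_combination hRv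

theorem exists_eq_gbIIMeasure [IsProbabilityMeasure ρ] [IsProbabilityMeasure σ]
    (H : IndepPreserving α β μ ν ρ σ) (hα : 0 < α) (hβ : 0 < β)
    (hαβ : α ≠ β) (hμ : ∀ c, μ ≠ Measure.dirac c) (hν : ∀ c, ν ≠ Measure.dirac c) :
    ∃ a b lam : ℝ, 0 < a ∧ 0 < b ∧ |lam| < min a b ∧
      μ = gbIIMeasure lam a b α ∧ ν = gbIIMeasure (-lam) a b β ∧
      ρ = gbIIMeasure (-lam) a b α ∧ σ = gbIIMeasure lam a b β := by
  obtain ⟨c, b, t, hc, hb, ht, hcb, h⟩ := H.exists_contiguous hα hβ hαβ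
  have ht' : 0 < t := by
    refine lt_of_le_of_ne ht fun h0 => ?_
    subst h0
    refine H.not_ae_quadratic hα hβ hαβ hμ hν hc.ne'
      (ae_quadratic_of_contiguous (c := c) (b := b) hβ H.pos_σ fun n => ?_)
    simpa using (h n).1
  obtain ⟨lam, hlam⟩ : ∃ lam, lam = (c - b) / (2 * t) := ⟨_, rfl⟩
  obtain ⟨q, hq⟩ : ∃ q, q = (c + b) / (2 * t) := ⟨_, rfl⟩
  obtain ⟨p, hp⟩ : ∃ p, p = 1 / (β * t) - lam := ⟨_, rfl⟩
  have e₁ : c = t * (q + lam) := by rw [hq, hlam]; field_simp; ring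
  have e₂ : b = t * (q - lam) := by rw [hq, hlam]; field_simp; ring
  have e₃ : 1 = t * (β * (p + lam)) := by rw [hp]; field_simp; ring
  have q₁ : 0 < q + lam := pos_of_mul_pos_right (e₁ ▸ hc) ht'.le
  have q₂ : 0 < q - lam := pos_of_mul_pos_right (e₂ ▸ hb) ht'.le
  have p₁ : 0 < p + lam := by rw [hp, sub_add_cancel]; positivity
  have p₂ : 0 < p - lam := by
    have : 1 / β = t * (p + lam) := by rw [hp]; field_simp; ring
    rw [this, e₁, e₂] at hcb
    nlinarith
  refine ⟨p, q, lam, by linarith, by linarith, ?_, ?_, ?_, ?_, ?_⟩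
  · rw [abs_lt]
    constructor
    · rw [← neg_lt_neg_iff, neg_neg, lt_min_iff]; constructor <;> linarith
    · rw [lt_min_iff]; constructor <;> linarith
  · refine eq_gbIIMeasure_of_betaMoment (k := α / β) hα H.pos_μ ht' q₁ p₂ e₁ e₂
      ?_ fun n => ?_
    · field_simp; linear_combination e₃
    · field_simp; linear_combination (h n).2.1
  · refine eq_gbIIMeasure_of_betaMoment_dual (k := 1) hβ H.pos_ν ht' (by linarith)
      (by linarith) (e₂.trans (by ring)) (e₁.trans (by ring)) (e₃.trans (by ring)) fun n => ?_
    linear_combination (h n).2.2.1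
  · refine eq_gbIIMeasure_of_betaMoment_dual (k := α / β) hα H.pos_ρ ht' (by linarith)
      (by linarith) (e₂.trans (by ring)) (e₁.trans (by ring)) ?_ fun n => ?_
    · field_simp; linear_combination e₃
    · field_simp; linear_combination (h n).2.2.2
  · refine eq_gbIIMeasure_of_betaMoment (k := 1) hβ H.pos_σ ht' q₁ p₂ e₁ e₂ e₃ fun n => ?_
    linear_combination (h n).1

end IndepPreserving

theorem theorem2 {Ω : Type*} [MeasurableSpace Ω] (P : Measure Ω) [IsProbabilityMeasure P]
    (α β : ℝ) (hα : 0 < α) (hβ : 0 < β) (hαβ : α ≠ β)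
    (X Y U V : Ω → ℝ) (hX : Measurable X) (hY : Measurable Y)
    (hXpos : ∀ᵐ ω ∂P, 0 < X ω) (hYpos : ∀ᵐ ω ∂P, 0 < Y ω)
    (hXnd : ∀ c : ℝ, P.map X ≠ Measure.dirac c) (hYnd : ∀ c : ℝ, P.map Y ≠ Measure.dirac c)
    (hXY : IndepFun X Y P)
    (hUV : ∀ ω, (U ω, V ω) = quadrirationalYB α β (X ω, Y ω))
    (hindep : IndepFun U V P) :
    ∃ a b lam : ℝ, 0 < a ∧ 0 < b ∧ |lam| < min a b ∧
      HasLaw (fun ω => (X ω, Y ω))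
        ((gbIIMeasure lam a b α).prod (gbIIMeasure (-lam) a b β)) P ∧
      HasLaw (fun ω => (U ω, V ω))
        ((gbIIMeasure (-lam) a b α).prod (gbIIMeasure lam a b β)) P := by
  have hXYm : Measurable fun ω => (X ω, Y ω) := hX.prodMk hY
  have hUVm : Measurable fun ω => (U ω, V ω) := by
    simp only [hUV]
    exact (measurable_quadrirationalYB α β).comp hXYm
  have hU : Measurable U := measurable_fst.comp hUVm
  have hV : Measurable V := measurable_snd.comp hUVm
  have := Measure.isProbabilityMeasure_map (μ := P) hX.aemeasurable
  have := Measure.isProbabilityMeasure_map (μ := P) hY.aemeasurable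
  have := Measure.isProbabilityMeasure_map (μ := P) hU.aemeasurable
  have := Measure.isProbabilityMeasure_map (μ := P) hV.aemeasurable
  have hXYlaw := (indepFun_iff_map_prod_eq_prod_map_map hX.aemeasurable hY.aemeasurable).1 hXY
  have hUVlaw := (indepFun_iff_map_prod_eq_prod_map_map hU.aemeasurable hV.aemeasurable).1 hindep
  have hUVpos : ∀ᵐ ω ∂P, 0 < U ω ∧ 0 < V ω := by
    filter_upwards [hXpos, hYpos] with ω hx hy
    have h := quadrirationalYB_pos hα hβ hx hy
    rw [← hUV ω] at h
    exact h
  have H : IndepPreserving α β (P.map X) (P.map Y) (P.map U) (P.map V) :=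
    { pos_μ := (ae_map_iff hX.aemeasurable measurableSet_Ioi).2 hXpos
      pos_ν := (ae_map_iff hY.aemeasurable measurableSet_Ioi).2 hYpos
      pos_ρ := (ae_map_iff hU.aemeasurable measurableSet_Ioi).2 (hUVpos.mono fun _ h => h.1)
      pos_σ := (ae_map_iff hV.aemeasurable measurableSet_Ioi).2 (hUVpos.mono fun _ h => h.2)
      map_eq := by
        rw [← hXYlaw, ← hUVlaw, Measure.map_map (measurable_quadrirationalYB α β) hXYm]
        exact congrArg (fun f => P.map f) (funext fun ω => (hUV ω).symm) }
  obtain ⟨a, b, lam, ha, hb, hlam, h₁, h₂, h₃, h₄⟩ := H.exists_eq_gbIIMeasure hα hβ hαβ hXnd hYnd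
  refine ⟨a, b, lam, ha, hb, hlam, ⟨hXYm.aemeasurable, ?_⟩, ⟨hUVm.aemeasurable, ?_⟩⟩
  · rw [hXYlaw, h₁, h₂]
  · rw [hUVlaw, h₃, h₄]
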